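/- **Setting.** Let $\mathcal X\subset\mathbb R^{d_1}$ and $\mathcal Y\subset\mathbb R^{d_2}$ be nonempty, compact and convex, and let $f:\mathcal X\times\mathcal Y\to\mathbb R$ be convex in $x$ and concave in $y$, with partial gradients $\nabla_xf,\nabla_yf$ on $\mathcal X\times\mathcal Y$. Fix a norm on each of $\mathbb R^{d_1},\mathbb R^{d_2}$, both written $\|\cdot\|$, with dual norm $\|x\|_*=\sup\{\langle u,x\rangle:\|u\|\le 1\}$. Let $\Psi_1=\sup_{x\ne0}\|x\|/\|x\|_2$ and $\Psi_2=\sup_{x\neq 0}\|x\|_2/\|x\|$ (each the larger of the two values for the two spaces) and $D=\max\{\sup_{x_1,x_2\in\mathcal X}\|x_1-x_2\|,\ \sup_{y_1,y_2\in\mathcal Y}\|y_1-y_2\|\}$. Suppose that for some $\alpha\in[0,1]$ and $L_1,L_2\ge 0$, for all $x,x'\in\mathcal X$ and $y,y'\in\mathcal Y$, $$\|\nabla_xf(x,y)-\nabla_xf(x',y')\|_*\le L_1\|x-x'\|^\alpha+L_2\|y-y'\|^\alpha,$$ $$\|\nabla_yf(x,y)-\nabla_yf(x',y')\|_*\le L_2\|x-x'\|^\alpha+L_1\|y-y'\|^\alpha$$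 (where, if $\alpha=0$, $\|v\|^\alpha$ is read as $0$ for $v=0$), and put $L=\max\{L_1,L_2\}$. **Perturbations.** Let $P^1,P^2$ be probability distributions on $\mathbb R^{d_1},\mathbb R^{d_2}$ that are absolutely continuous with respect to Lebesgue measure and satisfy $\mathbb E_{\sigma\sim P^1}\|\sigma\|_*=\mathbb E_{\sigma\sim P^2}\|\sigma\|_*=\eta<\infty$. Let $C\ge0$ be such that the predictions of both players are $C\eta^{-1}$-stable w.r.t. $\|\cdot\|_*$: the map $\nabla\Phi_{\mathcal X}(g)=\mathbb E_{\sigma\sim P^1}[\operatorname{argmin}_{x\in\mathcal X}\langle g-\sigma,x\rangle]$ satisfies $\|\nabla\Phi_{\mathcal X}(g_1)-\nabla\Phi_{\mathcal X}(g_2)\|_{**}\le C\eta^{-1}\|g_1-g_2\|_*$ for all $g_1,g_2\in\mathbb R^{d_1}$ (where $\|\cdot\|_{**}$ is the dual norm of $\|\cdot\|_*$), and likewise for $\mathcal Y$, $P^2$, $\mathbb R^{d_2}$. **Algorithm.** Let $T,m\ge1$. All perturbations below are drawn independently of each other, those of the $x$ player from $P^1$ and those of the $y$ player from $P^2$. In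 each round $t=1,\dots,T$, put $G^x_t=\sum_{i<t}\nabla_xf(x_i,y_i)$ and $G^y_t=\sum_{i<t}\nabla_yf(x_i,y_i)$. 1. (Predictions with zero guess.) Draw $\tilde\sigma^1_{t,j},\tilde\sigma^2_{t,j}$ and choose $\tilde x_{t-1,j}\in\operatorname{argmin}_{x\in\mathcal X}\langle G^x_t-\tilde\sigma^1_{t,j},x\rangle$ and $\tilde y_{t-1,j}\in\operatorname{argmax}_{y\in\mathcal Y}\langle G^y_t+\tilde\sigma^2_{t,j},y\rangle$ for $j=1,\dots,m$. Let $\tilde x_{t-1}=\frac1m\sum_j\tilde x_{t-1,j}$ and $\tilde y_{t-1}=\frac1m\sum_j\tilde y_{t-1,j}$. 2. (Actions with the guesses $\nabla_xf(\tilde x_{t-1},\tilde y_{t-1})$, $\nabla_yf(\tilde x_{t-1},\tilde y_{t-1})$.) Draw $\sigma^1_{t,j},\sigma^2_{t,j}$ and choose $x_{t,j}\in\operatorname{argmin}_{x\in\mathcal X}\langle G^x_t+\nabla_xf(\tilde x_{t-1},\tilde y_{t-1})-\sigma^1_{t,j},x\rangle$ and $y_{t,j}\in\operatorname{argmax}_{y\in\mathcal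 Y}\langle G^y_t+\nabla_yf(\tilde x_{t-1},\tilde y_{t-1})+\sigma^2_{t,j},y\rangle$ for $j=1,\dots,m$. The players play $x_t=\frac1m\sum_jx_{t,j}$ and $y_t=\frac1m\sum_jy_{t,j}$. **Conclusion.** If $\alpha<1$, then $$\sup_{x\in\mathcal X,\,y\in\mathcal Y}\mathbb E\Big[f\Big(\tfrac1T\sum_{t=1}^Tx_t,\,y\Big)-f\Big(x,\,\tfrac1T\sum_{t=1}^Ty_t\Big)\Big]\le 2L_1\Big(\tfrac{\Psi_1\Psi_2D}{\sqrt m}\Big)^{1+\alpha}+\frac{2\eta D}{T}+\frac{20CL^2}{\eta}\Big(\tfrac{\Psi_1\Psi_2D}{\sqrt m}\Big)^{2\alpha}+10L\Big(\tfrac{5CL}{\eta}\Big)^{\frac{1+\alpha}{1-\alpha}}.$$ If $\alpha=1$ and $\eta\ge5CL$, the same bound holds without the last term. -/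

import Mathlib

open MeasureTheory ProbabilityTheory

noncomputable section

/-- `ℝ^d` with its Euclidean structure. -/
abbrev Vec (d : ℕ) : Type := EuclideanSpace ℝ (Fin d)

/-- The dual norm `N_*(x) = sup {⟨u, x⟩ : N u ≤ 1}`. -/
def dualNorm {d : ℕ} (N : Vec d → ℝ) (x : Vec d) : ℝ :=
  sSup {r : ℝ | ∃ u : Vec d, N u ≤ 1 ∧ r = inner ℝ u x}

/-- The compatibility constant `sup_{x ≠ 0} N x / ‖x‖₂`. -/
def compatConst₁ {d : ℕ} (N : Vec d → ℝ) : ℝ :=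
  sSup {r : ℝ | ∃ x : Vec d, x ≠ 0 ∧ r = N x / ‖x‖}

/-- The compatibility constant `sup_{x ≠ 0} ‖x‖₂ / N x`. -/
def compatConst₂ {d : ℕ} (N : Vec d → ℝ) : ℝ :=
  sSup {r : ℝ | ∃ x : Vec d, x ≠ 0 ∧ r = ‖x‖ / N x}

/-- The diameter of `X` with respect to `N`. -/
def normDiam {d : ℕ} (N : Vec d → ℝ) (X : Set (Vec d)) : ℝ :=
  sSup {r : ℝ | ∃ x₁ ∈ X, ∃ x₂ ∈ X, r = N (x₁ - x₂)}

/-- The Hölder modulus `t ↦ t ^ α` for `t ≥ 0`, always vanishing at `t = 0`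
(this differs from `Real.rpow` only when `α = 0`). -/
def holderPow (α t : ℝ) : ℝ := if t = 0 then 0 else t ^ α

/-- `x ∈ argmin_{z ∈ X} ⟨g, z⟩`. -/
def IsLinearArgmin {d : ℕ} (X : Set (Vec d)) (g x : Vec d) : Prop :=
  x ∈ X ∧ ∀ z ∈ X, inner ℝ g x ≤ inner ℝ g z

/-- `x ∈ argmax_{z ∈ X} ⟨g, z⟩`. -/
def IsLinearArgmax {d : ℕ} (X : Set (Vec d)) (g x : Vec d) : Prop :=
  x ∈ X ∧ ∀ z ∈ X, inner ℝ g z ≤ inner ℝ g x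

/-- Some element of `argmin_{z ∈ X} ⟨g, z⟩` (such an element exists if `X` is compact and nonempty,
and it is unique for Lebesgue almost every `g`). -/
def linearArgmin {d : ℕ} (X : Set (Vec d)) (g : Vec d) : Vec d :=
  Classical.epsilon (IsLinearArgmin X g)

/-- The deterministic prediction `∇Φ(g) = E_{σ ∼ P} [argmin_{x ∈ X} ⟨g - σ, x⟩]`. -/
def gradPhi {d : ℕ} (X : Set (Vec d)) (P : Measure (Vec d)) (g : Vec d) : Vec d :=
  ∫ σ, linearArgmin X (g - σ) ∂P

/-- The predictions are `β`-stable with respect to the norm `N`: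
`N_*(∇Φ(g₁) - ∇Φ(g₂)) ≤ β N(g₁ - g₂)` for all `g₁, g₂`. -/
def PredictionsStable {d : ℕ} (N : Vec d → ℝ) (X : Set (Vec d)) (P : Measure (Vec d)) (β : ℝ) : Prop :=
  ∀ g₁ g₂ : Vec d, dualNorm N (gradPhi X P g₁ - gradPhi X P g₂) ≤ β * N (g₁ - g₂)

/-- The average of `m` vectors. -/
def vecMean {d m : ℕ} (v : Fin m → Vec d) : Vec d := (m : ℝ)⁻¹ • ∑ j, v j

/-- In each round, perturbations are drawn once for the guess and once for the action. -/
inductive Stage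
  | guess
  | act

/-- `T` rounds (numbered by `Fin T`) in which two players run optimistic follow the perturbed
leader against each other with `m` samples per prediction. `gx` and `gy` are the partial gradients
of the payoff. Ties in the argmin and argmax are broken arbitrarily. -/
structure OFTPLPlay {d₁ d₂ : ℕ} {Ω : Type*} [MeasurableSpace Ω] (μ : Measure Ω)
    (X : Set (Vec d₁)) (Y : Set (Vec d₂))
    (gx : Vec d₁ → Vec d₂ → Vec d₁) (gy : Vec d₁ → Vec d₂ → Vec d₂)
    (P₁ : Measure (Vec d₁)) (P₂ : Measure (Vec d₂)) (T m : ℕ) where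
  /-- The perturbations: the `j`-th pair `(σ¹, σ²)` of round `t` drawn at the given stage. -/
  noise : Stage → Fin T → Fin m → Ω → Vec d₁ × Vec d₂
  /-- The two players draw independently from `P₁` and `P₂`. -/
  noise_law : ∀ s t j, HasLaw (noise s t j) (P₁.prod P₂) μ
  /-- All pairs are mutually independent. -/
  noise_indep : iIndepFun (fun i : Stage × Fin T × Fin m => noise i.1 i.2.1 i.2.2) μ
  /-- The oracle answers used for the prediction with zero guess. -/
  xGuess : Fin T → Fin m → Ω → Vec d₁
  /-- The oracle answers used for the prediction with zero guess. -/
  yGuess : Fin T → Fin m → Ω → Vec d₂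
  /-- The oracle answers whose average is played. -/
  xAct : Fin T → Fin m → Ω → Vec d₁
  /-- The oracle answers whose average is played. -/
  yAct : Fin T → Fin m → Ω → Vec d₂
  xGuess_spec : ∀ t j ω, IsLinearArgmin X
    ((∑ i ∈ Finset.Iio t, gx (vecMean fun k => xAct i k ω) (vecMean fun k => yAct i k ω))
      - (noise Stage.guess t j ω).1) (xGuess t j ω)
  yGuess_spec : ∀ t j ω, IsLinearArgmax Y
    ((∑ i ∈ Finset.Iio t, gy (vecMean fun k => xAct i k ω) (vecMean fun k => yAct i k ω))
      + (noise Stage.guess t j ω).2) (yGuess t j ω)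
  xAct_spec : ∀ t j ω, IsLinearArgmin X
    ((∑ i ∈ Finset.Iio t, gx (vecMean fun k => xAct i k ω) (vecMean fun k => yAct i k ω))
      + gx (vecMean fun k => xGuess t k ω) (vecMean fun k => yGuess t k ω)
      - (noise Stage.act t j ω).1) (xAct t j ω)
  yAct_spec : ∀ t j ω, IsLinearArgmax Y
    ((∑ i ∈ Finset.Iio t, gy (vecMean fun k => xAct i k ω) (vecMean fun k => yAct i k ω))
      + gy (vecMean fun k => xGuess t k ω) (vecMean fun k => yGuess t k ω)
      + (noise Stage.act t j ω).2) (yAct t j ω)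

namespace OFTPLPlay

variable {d₁ d₂ : ℕ} {Ω : Type*} [MeasurableSpace Ω] {μ : Measure Ω}
  {X : Set (Vec d₁)} {Y : Set (Vec d₂)}
  {gx : Vec d₁ → Vec d₂ → Vec d₁} {gy : Vec d₁ → Vec d₂ → Vec d₂}
  {P₁ : Measure (Vec d₁)} {P₂ : Measure (Vec d₂)} {T m : ℕ}

/-- The action of the minimizing player in round `t`. -/
def x (A : OFTPLPlay μ X Y gx gy P₁ P₂ T m) (t : Fin T) (ω : Ω) : Vec d₁ :=
  vecMean fun j => A.xAct t j ω

/-- The action of the maximizing player in round `t`. -/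
def y (A : OFTPLPlay μ X Y gx gy P₁ P₂ T m) (t : Fin T) (ω : Ω) : Vec d₂ :=
  vecMean fun j => A.yAct t j ω

end OFTPLPlay

end

/-! By convexity and concavity, `T` times the gap at `(x, y)` is at most the sum of the two
linearized regrets `∑ ⟨g_t, x_t - x⟩` and its analogue for the `y` player, whose loss gradients are
those of `-f`. One regret is bounded here; `OFTPLPlay.swap` yields the other.

Averaging over the perturbation makes the algorithm deterministic. The function `Φ(g) = E min_x ⟨g -
σ, x⟩` is concave with supergradient `gradPhi`, and the conditional mean of `x_t` is `∇Φ` at the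
past gradients plus the guess `h_t`. Stability says that `∇Φ` is Lipschitz with constant `β = C /
η`, so `Φ` is smooth and the analysis of optimistic follow the regularized leader applies
(`optimistic_step`, `optimistic_regret`). The regret of the conditional means is at most `η D + ∑
(β/2 ‖g_t - h_t‖_*² - p_t² / (2β))`, where `p_t` is the distance between the mean action and the
mean prediction with zero guess.

By Hölder smoothness, `g_t - h_t` is controlled by the distance from the action to the predicted
point, for each player. This splits into a sampling deviation of the action, the shift `p_t`, and a
sampling deviation of the prediction. Averages of `m` conditionally independent samples have squared
deviation at most `(Ψ₁ Ψ₂ D)² / m` in mean (`prediction_facts`, `deviation_facts`). Once both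
regrets are added, the shift terms meet the negative squares, and `shift_residual_le` bounds what
remains: a constant if `α < 1`, nothing if `α = 1` and `η ≥ 5 C L`.

Passing from the mean action to `x_t` itself costs `⟨g_t, x_t - mean⟩`. The gradient `g_t` depends
on `x_t`, but with the gradient taken at the mean action the pairing has expectation zero, because
`y_t` uses separate samples. That replacement costs `L₁` times the deviation to the power `1 + α`.
-/

noncomputable section

/-! ### Norms on `ℝ^d`, their duals and biduals -/

section Norms

variable {d : ℕ} (N : Seminorm ℝ (Vec d))

lemma continuous_seminorm_vec : Continuous N := by
  have h : ConvexOn ℝ Set.univ N := N.convexOn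
  exact continuousOn_univ.1 (h.continuousOn isOpen_univ)

variable {N}

/-- A norm on `ℝ^d` is bounded above and below by multiples of the Euclidean norm. -/
lemma exists_seminorm_bounds (hN : ∀ x, N x = 0 → x = 0) :
    ∃ c : ℝ, 0 < c ∧ (∀ x, N x ≤ c * ‖x‖) ∧ ∀ x, ‖x‖ ≤ c * N x := by
  have hs : IsCompact (Metric.sphere (0 : Vec d) 1) := isCompact_sphere 0 1
  have scale : ∀ x : Vec d, x ≠ 0 → ‖x‖⁻¹ • x ∈ Metric.sphere (0 : Vec d) 1 := by
    intro x hx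
    simp [norm_smul, norm_ne_zero_iff.2 hx]
  have scaleN : ∀ x : Vec d, N (‖x‖⁻¹ • x) = ‖x‖⁻¹ * N x := by
    intro x
    rw [map_smul_eq_mul]; simp
  -- The unit sphere is empty exactly in dimension zero; otherwise the constants are the extreme
  -- values of `N` on it.
  rcases (Metric.sphere (0 : Vec d) 1).eq_empty_or_nonempty with he | hne
  · have hz : ∀ x : Vec d, x = 0 := by
      intro x
      by_contra hx
      have := scale x hx
      rw [he] at this
      exact this
    refine ⟨1, one_pos, fun x => ?_, fun x => ?_⟩ <;> simp [hz x]
  obtain ⟨a, ha, hmin⟩ := hs.exists_isMinOn hne (continuous_seminorm_vec N).continuousOn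
  obtain ⟨b, hb, hmax⟩ := hs.exists_isMaxOn hne (continuous_seminorm_vec N).continuousOn
  have hane : a ≠ 0 := by
    rintro rfl
    simp at ha
  have hapos : 0 < N a := lt_of_le_of_ne (apply_nonneg N a) fun h => hane (hN a h.symm)
  refine ⟨max (N b) (N a)⁻¹, lt_max_of_lt_right (inv_pos.2 hapos), fun x => ?_, fun x => ?_⟩
  · by_cases hx : x = 0
    · simp [hx]
    have h := hmax (scale x hx)
    have hx' : 0 < ‖x‖ := norm_pos_iff.2 hx
    simp only [Set.mem_ofPred_eq, scaleN] at h
    rw [inv_mul_le_iff₀ hx', mul_comm] at h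
    exact h.trans (mul_le_mul_of_nonneg_right (le_max_left _ _) hx'.le)
  · by_cases hx : x = 0
    · simp [hx]
    have h := hmin (scale x hx)
    have hx' : 0 < ‖x‖ := norm_pos_iff.2 hx
    simp only [Set.mem_ofPred_eq, scaleN] at h
    rw [le_inv_mul_iff₀ hx'] at h
    calc ‖x‖ ≤ (N a)⁻¹ * N x := by rwa [le_inv_mul_iff₀ hapos, mul_comm]
      _ ≤ _ := mul_le_mul_of_nonneg_right (le_max_right _ _) (apply_nonneg N x)

lemma seminorm_le_compatConst (hN : ∀ x, N x = 0 → x = 0) (x : Vec d) :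
    N x ≤ compatConst₁ N * ‖x‖ := by
  by_cases hx : x = 0
  · simp [hx]
  obtain ⟨c, hc, h1, h2⟩ := exists_seminorm_bounds hN
  have hx' : 0 < ‖x‖ := norm_pos_iff.2 hx
  rw [← div_le_iff₀ hx']
  refine le_csSup ⟨c, ?_⟩ ⟨x, hx, rfl⟩
  rintro r ⟨y, hy, rfl⟩
  exact (div_le_iff₀ (norm_pos_iff.2 hy)).2 (h1 y)

lemma norm_le_compatConst (hN : ∀ x, N x = 0 → x = 0) (x : Vec d) :
    ‖x‖ ≤ compatConst₂ N * N x := by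
  by_cases hx : x = 0
  · simp [hx]
  obtain ⟨c, hc, h1, h2⟩ := exists_seminorm_bounds hN
  have hpos : ∀ y : Vec d, y ≠ 0 → 0 < N y := fun y hy =>
    lt_of_le_of_ne (apply_nonneg N y) fun h => hy (hN y h.symm)
  rw [← div_le_iff₀ (hpos x hx)]
  refine le_csSup ⟨c, ?_⟩ ⟨x, hx, rfl⟩
  rintro r ⟨y, hy, rfl⟩
  exact (div_le_iff₀ (hpos y hy)).2 (h2 y)

lemma compatConst₁_nonneg : 0 ≤ compatConst₁ N :=
  Real.sSup_nonneg (by rintro r ⟨x, -, rfl⟩; exact div_nonneg (apply_nonneg N x) (norm_nonneg x))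

lemma compatConst₂_nonneg : 0 ≤ compatConst₂ N :=
  Real.sSup_nonneg (by rintro r ⟨x, -, rfl⟩; exact div_nonneg (norm_nonneg x) (apply_nonneg N x))

lemma dualNorm_le {x : Vec d} {b : ℝ} (h : ∀ u, N u ≤ 1 → inner ℝ u x ≤ b) :
    dualNorm N x ≤ b := by
  refine csSup_le ⟨0, 0, by simp, by simp⟩ ?_
  rintro r ⟨u, hu, rfl⟩
  exact h u hu

lemma dualNorm_bddAbove (hN : ∀ x, N x = 0 → x = 0) (x : Vec d) :
    BddAbove {r : ℝ | ∃ u : Vec d, N u ≤ 1 ∧ r = inner ℝ u x} := by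
  obtain ⟨c, hc, -, h2⟩ := exists_seminorm_bounds hN
  refine ⟨c * ‖x‖, ?_⟩
  rintro r ⟨u, hu, rfl⟩
  refine (real_inner_le_norm u x).trans (mul_le_mul_of_nonneg_right ?_ (norm_nonneg x))
  exact (h2 u).trans (mul_le_of_le_one_right hc.le hu)

lemma inner_le_dualNorm (hN : ∀ x, N x = 0 → x = 0) {u : Vec d} (hu : N u ≤ 1) (x : Vec d) :
    inner ℝ u x ≤ dualNorm N x :=
  le_csSup (dualNorm_bddAbove hN x) ⟨u, hu, rfl⟩

lemma dualNorm_nonneg (hN : ∀ x, N x = 0 → x = 0) (x : Vec d) : 0 ≤ dualNorm N x := by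
  simpa using inner_le_dualNorm hN (u := 0) (by simp) x

/-- Hölder's inequality for a norm and its dual. -/
lemma inner_le_mul_dualNorm (hN : ∀ x, N x = 0 → x = 0) (u x : Vec d) :
    inner ℝ u x ≤ N u * dualNorm N x := by
  by_cases hu : u = 0
  · simp [hu]
  have hpos : 0 < N u := lt_of_le_of_ne (apply_nonneg N u) fun h => hu (hN u h.symm)
  have h := inner_le_dualNorm hN (u := (N u)⁻¹ • u) (by
    rw [map_smul_eq_mul, Real.norm_of_nonneg (inv_nonneg.2 hpos.le), inv_mul_cancel₀ hpos.ne']) x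
  rwa [real_inner_smul_left, inv_mul_le_iff₀ hpos] at h

lemma dualNorm_add_le (hN : ∀ x, N x = 0 → x = 0) (x y : Vec d) :
    dualNorm N (x + y) ≤ dualNorm N x + dualNorm N y :=
  dualNorm_le fun u hu => by
    rw [inner_add_right]
    exact add_le_add (inner_le_dualNorm hN hu x) (inner_le_dualNorm hN hu y)

lemma dualNorm_smul_le (hN : ∀ x, N x = 0 → x = 0) (c : ℝ) (x : Vec d) :
    dualNorm N (c • x) ≤ ‖c‖ * dualNorm N x := by
  refine dualNorm_le fun u hu => ?_
  rw [real_inner_smul_right]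
  have h1 := inner_le_dualNorm hN hu x
  have h2 := inner_le_dualNorm hN (u := -u) (by rwa [map_neg_eq_map]) x
  rw [inner_neg_left] at h2
  calc c * inner ℝ u x ≤ |c * inner ℝ u x| := le_abs_self _
    _ = ‖c‖ * |inner ℝ u x| := by rw [abs_mul, Real.norm_eq_abs]
    _ ≤ _ := mul_le_mul_of_nonneg_left (abs_le.2 ⟨by linarith, h1⟩) (norm_nonneg c)

/-- The dual norm of a norm, as a seminorm. -/
def dualSeminorm (N : Seminorm ℝ (Vec d)) (hN : ∀ x, N x = 0 → x = 0) : Seminorm ℝ (Vec d) :=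
  Seminorm.ofSMulLE (dualNorm N) (le_antisymm (dualNorm_le (by simp)) (dualNorm_nonneg hN 0))
    (dualNorm_add_le hN) (dualNorm_smul_le hN)

lemma coe_dualSeminorm (hN : ∀ x, N x = 0 → x = 0) : ⇑(dualSeminorm N hN) = dualNorm N := rfl

lemma dualSeminorm_definite (hN : ∀ x, N x = 0 → x = 0) (x : Vec d)
    (hx : dualSeminorm N hN x = 0) : x = 0 := by
  have h := inner_le_mul_dualNorm hN x x
  rw [← coe_dualSeminorm hN, hx, mul_zero] at h
  exact real_inner_self_nonpos.1 h

/-- Every vector is normed by some functional in the dual unit ball. -/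
lemma exists_dualNorm_le_one_inner_eq (x : Vec d) :
    ∃ v : Vec d, dualNorm N v ≤ 1 ∧ inner ℝ v x = N x := by
  have hz : ∀ c : ℝ, c • x = 0 → c • N x = 0 := by
    intro c hc
    rcases smul_eq_zero.1 hc with h | h <;> simp [h]
  -- Hahn–Banach: the functional `c • x ↦ c * N x` on the line through `x` is dominated by `N` and
  -- extends with the same domination.
  obtain ⟨g, hg, hgN⟩ := exists_extension_of_le_sublinear
    (LinearPMap.mkSpanSingleton' x (N x) hz) N
    (fun c hc y => by rw [map_smul_eq_mul, Real.norm_of_nonneg hc.le]) (map_add_le_add N) (by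
      rintro ⟨y, hy⟩
      obtain ⟨c, rfl⟩ := Submodule.mem_span_singleton.1 hy
      erw [LinearPMap.mkSpanSingleton'_apply]
      rw [map_smul_eq_mul, smul_eq_mul]
      exact mul_le_mul_of_nonneg_right (Real.le_norm_self c) (apply_nonneg N x))
  have hx : g x = N x := by
    have h := hg ⟨x, Submodule.mem_span_singleton_self x⟩
    have h2 := LinearPMap.mkSpanSingleton'_apply_self (R := ℝ) (σ := RingHom.id ℝ) x (N x) hz
      (Submodule.mem_span_singleton_self x)
    exact h.trans h2
  refine ⟨(InnerProductSpace.toDual ℝ (Vec d)).symm g.toContinuousLinearMap, ?_, ?_⟩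
  · refine dualNorm_le fun u hu => ?_
    rw [real_inner_comm, InnerProductSpace.toDual_symm_apply]
    exact (hgN u).trans hu
  · rw [InnerProductSpace.toDual_symm_apply]
    exact hx

/-- Stability measures increments of `∇Φ` in the bidual norm; this half of reflexivity suffices to
convert it into a bound in `N`. -/
lemma le_dualNorm_dualNorm (hN : ∀ x, N x = 0 → x = 0) (x : Vec d) :
    N x ≤ dualNorm (dualNorm N) x := by
  obtain ⟨v, hv, hvx⟩ := exists_dualNorm_le_one_inner_eq (N := N) x
  rw [← hvx]
  exact inner_le_dualNorm (N := dualSeminorm N hN) (dualSeminorm_definite hN) hv x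

lemma sub_le_normDiam {X : Set (Vec d)} (hX : IsCompact X) {x y : Vec d} (hx : x ∈ X)
    (hy : y ∈ X) : N (x - y) ≤ normDiam N X := by
  have hc : Continuous fun p : Vec d × Vec d => N (p.1 - p.2) :=
    (continuous_seminorm_vec N).comp (continuous_fst.sub continuous_snd)
  obtain ⟨b, hb⟩ := ((hX.prod hX).image hc).bddAbove
  refine le_csSup ⟨b, ?_⟩ ⟨x, hx, y, hy, rfl⟩
  rintro r ⟨x₁, h1, x₂, h2, rfl⟩
  exact hb ⟨(x₁, x₂), ⟨h1, h2⟩, rfl⟩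

lemma normDiam_nonneg {X : Set (Vec d)} : 0 ≤ normDiam N X :=
  Real.sSup_nonneg (by rintro r ⟨x, -, y, -, rfl⟩; exact apply_nonneg N _)

end Norms

/-! ### Almost everywhere uniqueness and measurable selection of linear minimizers -/

section Selection

variable {d : ℕ} {X : Set (Vec d)}

lemma exists_isLinearArgmin (hX : IsCompact X) (hXn : X.Nonempty) (g : Vec d) :
    ∃ x, IsLinearArgmin X g x := by
  obtain ⟨x, hx, h⟩ := hX.exists_isMinOn hXn
    (Continuous.continuousOn (f := fun z : Vec d => (inner ℝ g z : ℝ)) (by fun_prop))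
  exact ⟨x, hx, fun z hz => h hz⟩

lemma linearArgmin_spec (hX : IsCompact X) (hXn : X.Nonempty) (g : Vec d) :
    IsLinearArgmin X g (linearArgmin X g) :=
  Classical.epsilon_spec (exists_isLinearArgmin hX hXn g)

/-- For Lebesgue almost every `g` the minimizer of `⟨g, ·⟩` is unique, and it is given by a
measurable function of `g`, the gradient of the minimum. -/
lemma exists_measurable_argmin (hX : IsCompact X) (hXn : X.Nonempty) :
    ∃ S : Vec d → Vec d, Measurable S ∧ (∀ g, S g ∈ X) ∧
      ∀ᵐ g ∂(volume : Measure (Vec d)), ∀ x, IsLinearArgmin X g x → x = S g := by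
  classical
  obtain ⟨x₀, hx₀⟩ := hXn
  obtain ⟨R, hR⟩ := hX.isBounded.exists_norm_le
  have hspec := linearArgmin_spec hX ⟨x₀, hx₀⟩
  set φ : Vec d → ℝ := fun g => inner ℝ g (linearArgmin X g) with hφ
  have hR0 : 0 ≤ R := (norm_nonneg _).trans (hR x₀ hx₀)
  -- An infimum of linear functionals with norms at most `R` is `R`-Lipschitz, so Rademacher's
  -- theorem applies to `φ`.
  have hlip : LipschitzWith R.toNNReal φ := by
    refine LipschitzWith.of_le_add_mul _ fun g g' => ?_
    have h1 : φ g ≤ inner ℝ g (linearArgmin X g') := (hspec g).2 _ (hspec g').1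
    have h2 : (inner ℝ g (linearArgmin X g') : ℝ) = φ g' + inner ℝ (g - g') (linearArgmin X g') := by
      rw [hφ, inner_sub_left]; ring
    have h3 : (inner ℝ (g - g') (linearArgmin X g') : ℝ) ≤ R * dist g g' := by
      rw [dist_eq_norm, mul_comm]
      exact (real_inner_le_norm _ _).trans
        (mul_le_mul_of_nonneg_left (hR _ (hspec g').1) (norm_nonneg _))
    rw [Real.coe_toNNReal R hR0]
    linarith
  set G : Vec d → Vec d := fun g => (InnerProductSpace.toDual ℝ (Vec d)).symm (fderiv ℝ φ g) with hG
  have hGm : Measurable G :=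
    (InnerProductSpace.toDual ℝ (Vec d)).symm.continuous.measurable.comp (measurable_fderiv ℝ φ)
  have huniq : ∀ g, DifferentiableAt ℝ φ g → ∀ x, IsLinearArgmin X g x → x = G g := by
    intro g hg x hx
    -- The linear functional `⟨x, ·⟩` lies above `φ` and touches it at `g`, so their derivatives at
    -- `g` agree.
    have hmin : IsLocalMin (fun g' => (inner ℝ x g' : ℝ) - φ g') g := by
      refine Filter.Eventually.of_forall fun g' => ?_
      have h1 : φ g' ≤ inner ℝ g' x := (hspec g').2 x hx.1
      have h2 : (inner ℝ g x : ℝ) ≤ φ g := hx.2 _ (hspec g).1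
      have h3 : φ g ≤ inner ℝ g x := (hspec g).2 x hx.1
      simp only [real_inner_comm] at h1 h2 h3 ⊢
      linarith
    have hd : HasFDerivAt (fun g' => (inner ℝ x g' : ℝ) - φ g') (innerSL ℝ x - fderiv ℝ φ g) g :=
      ((innerSL ℝ x).hasFDerivAt).sub hg.hasFDerivAt
    have h0 := hmin.hasFDerivAt_eq_zero hd
    have : fderiv ℝ φ g = InnerProductSpace.toDual ℝ (Vec d) x := by
      rw [sub_eq_zero] at h0
      rw [← h0]; rfl
    rw [hG]
    simp only [this]
    simp
  -- Where `φ` is not differentiable, `fderiv` is zero by default and `G g = 0` may lie outside `X`;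
  -- the fallback `x₀` keeps the selection in `X`.
  refine ⟨fun g => if G g ∈ X then G g else x₀, ?_, ?_, ?_⟩
  · exact Measurable.ite (hGm hX.isClosed.measurableSet) hGm measurable_const
  · intro g
    by_cases h : G g ∈ X
    · simp [h]
    · simp [h, hx₀]
  · filter_upwards [hlip.ae_differentiableAt] with g hg x hx
    have h := huniq g hg x hx
    rw [if_pos (h ▸ hx.1)]
    exact h

/-- Since `σ ↦ g - σ` preserves Lebesgue measure, an absolutely continuous perturbation makes every
fixed objective generic almost surely. -/
lemma ae_sub_left {P : Measure (Vec d)} (hP : P ≪ volume) {p : Vec d → Prop}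
    (h : ∀ᵐ g ∂(volume : Measure (Vec d)), p g) (g : Vec d) : ∀ᵐ σ ∂P, p (g - σ) :=
  hP.ae_le ((Measure.measurePreserving_sub_left volume g).quasiMeasurePreserving.ae h)

end Selection

/-! ### The perturbed potential and its supergradient -/

section Potential

variable {d : ℕ} {X : Set (Vec d)} {P : Measure (Vec d)}

lemma integrable_linearArgmin [IsFiniteMeasure P] (hX : IsCompact X) (hXn : X.Nonempty)
    (hP : P ≪ volume) (g : Vec d) : Integrable (fun σ => linearArgmin X (g - σ)) P := by
  obtain ⟨S, hS, hSX, hSu⟩ := exists_measurable_argmin hX hXn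
  obtain ⟨R, hR⟩ := hX.isBounded.exists_norm_le
  have hm : AEStronglyMeasurable (fun σ => linearArgmin X (g - σ)) P := by
    refine ((hS.comp (measurable_const.sub measurable_id)).aestronglyMeasurable).congr
      (f := S ∘ fun σ => g - σ) ?_
    filter_upwards [ae_sub_left hP hSu g] with σ hσ
    exact (hσ _ (linearArgmin_spec hX hXn _)).symm
  exact Integrable.of_bound hm R (Filter.Eventually.of_forall fun σ =>
    hR _ (linearArgmin_spec hX hXn _).1)

lemma gradPhi_mem [IsProbabilityMeasure P] (hX : IsCompact X) (hXc : Convex ℝ X)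
    (hXn : X.Nonempty) (hP : P ≪ volume) (g : Vec d) : gradPhi X P g ∈ X :=
  hXc.integral_mem hX.isClosed
    (Filter.Eventually.of_forall fun σ => (linearArgmin_spec hX hXn (g - σ)).1)
    (integrable_linearArgmin hX hXn hP g)

/-- The choice made by `linearArgmin` need not be measurable; passing to a selection `S` permits the
use of Fubini's theorem. -/
lemma gradPhi_eq_integral {S : Vec d → Vec d} (hX : IsCompact X) (hXn : X.Nonempty)
    (hP : P ≪ volume)
    (hSu : ∀ᵐ g ∂(volume : Measure (Vec d)), ∀ x, IsLinearArgmin X g x → x = S g) (g : Vec d) :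
    gradPhi X P g = ∫ σ, S (g - σ) ∂P := by
  refine integral_congr_ae ?_
  filter_upwards [ae_sub_left hP hSu g] with σ hσ
  exact hσ _ (linearArgmin_spec hX hXn _)

lemma integrable_of_integrable_dualNorm {N : Seminorm ℝ (Vec d)} (hN : ∀ x, N x = 0 → x = 0)
    (hint : Integrable (dualNorm N) P) : Integrable (fun σ : Vec d => σ) P := by
  obtain ⟨c, hc, -, h2⟩ := exists_seminorm_bounds (dualSeminorm_definite hN)
  refine (hint.const_mul c).mono' measurable_id.aestronglyMeasurable
    (Filter.Eventually.of_forall fun σ => h2 σ)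

/-- The expected minimum `Φ(g) = E [min_{x ∈ X} ⟨g - σ, x⟩]` is a concave function with
supergradient `∇Φ`, and its growth is controlled by the size of the perturbation. -/
lemma exists_potential [IsProbabilityMeasure P] (hX : IsCompact X) (hXn : X.Nonempty)
    (hP : P ≪ volume) {N : Seminorm ℝ (Vec d)} (hN : ∀ x, N x = 0 → x = 0)
    (hint : Integrable (dualNorm N) P) :
    ∃ Φ : Vec d → ℝ, (∀ g g', Φ g' ≤ Φ g + inner ℝ (g' - g) (gradPhi X P g)) ∧
      ∀ g, ∀ x ∈ X, Φ g - Φ 0 ≤ inner ℝ g x + normDiam N X * ∫ σ, dualNorm N σ ∂P := by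
  obtain ⟨R, hR⟩ := hX.isBounded.exists_norm_le
  have hspec := linearArgmin_spec hX hXn
  have hid := integrable_of_integrable_dualNorm hN hint
  have hinn : ∀ g g' : Vec d,
      Integrable (fun σ => (inner ℝ (g' - σ) (linearArgmin X (g - σ)) : ℝ)) P := by
    intro g g'
    have h1 : Integrable (fun σ => g' - σ) P := (integrable_const g').sub hid
    refine (h1.norm.mul_const R).mono'
      (h1.aestronglyMeasurable.inner (integrable_linearArgmin hX hXn hP g).aestronglyMeasurable)
      (Filter.Eventually.of_forall fun σ => ?_)
    exact (norm_inner_le_norm _ _).trans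
      (mul_le_mul_of_nonneg_left (hR _ (hspec _).1) (norm_nonneg _))
  refine ⟨fun g => ∫ σ, inner ℝ (g - σ) (linearArgmin X (g - σ)) ∂P, fun g g' => ?_,
    fun g x hx => ?_⟩
  · have h1 : inner ℝ (g' - g) (gradPhi X P g)
        = ∫ σ, inner ℝ (g' - g) (linearArgmin X (g - σ)) ∂P :=
      (integral_inner (integrable_linearArgmin hX hXn hP g) _).symm
    rw [h1, ← integral_add (hinn g g) ((integrable_linearArgmin hX hXn hP g).const_inner _)]
    refine integral_mono (hinn g' g') ((hinn g g).add
      ((integrable_linearArgmin hX hXn hP g).const_inner _)) fun σ => ?_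
    have h2 : (inner ℝ (g' - σ) (linearArgmin X (g' - σ)) : ℝ)
        ≤ inner ℝ (g' - σ) (linearArgmin X (g - σ)) := (hspec _).2 _ (hspec _).1
    refine h2.trans (le_of_eq ?_)
    simp only [inner_sub_left]; ring
  · have hc : inner ℝ g x + normDiam N X * ∫ σ, dualNorm N σ ∂P
        = ∫ σ, (inner ℝ g x + normDiam N X * dualNorm N σ) ∂P := by
      rw [integral_add (integrable_const _) (hint.const_mul _), integral_const_mul]
      simp
    rw [hc, ← integral_sub (hinn g g) (hinn 0 0)]
    refine integral_mono ((hinn g g).sub (hinn 0 0))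
      ((integrable_const _).add (hint.const_mul _)) fun σ => ?_
    have h1 : (inner ℝ (g - σ) (linearArgmin X (g - σ)) : ℝ) ≤ inner ℝ (g - σ) x :=
      (hspec _).2 _ hx
    -- Comparing the two minima through `x` leaves `⟨x_σ - x, σ⟩`, with `x_σ` the minimizer for
    -- `-σ`; this is at most the diameter times the dual norm of `σ`.
    have h2 := inner_le_mul_dualNorm hN (linearArgmin X (0 - σ) - x) σ
    have h3 : N (linearArgmin X (0 - σ) - x) * dualNorm N σ ≤ normDiam N X * dualNorm N σ :=
      mul_le_mul_of_nonneg_right (sub_le_normDiam hX (hspec _).1 hx) (dualNorm_nonneg hN σ)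
    rw [inner_sub_left, real_inner_comm, real_inner_comm σ x] at h2
    simp only [inner_sub_left, inner_zero_left] at h1 ⊢
    linarith

end Potential

/-! ### Smoothness of the potential and optimistic regret -/

section Smoothness

variable {d : ℕ} {N : Seminorm ℝ (Vec d)} {Φ : Vec d → ℝ} {G : Vec d → Vec d} {β : ℝ}

/-- A concave function with a Lipschitz supergradient is smooth. -/
lemma smooth_of_lipschitz_supergradient (hN : ∀ x, N x = 0 → x = 0)
    (hsup : ∀ a b, Φ b ≤ Φ a + inner ℝ (b - a) (G a))
    (hlip : ∀ a b, N (G a - G b) ≤ β * dualNorm N (a - b)) (a c : Vec d) :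
    Φ a + inner ℝ (c - a) (G a) - β / 2 * dualNorm N (c - a) ^ 2 ≤ Φ c := by
  set v := c - a with hv
  set K := dualNorm N v with hK
  have hK0 : 0 ≤ K := dualNorm_nonneg hN v
  -- No derivative of `Φ` is needed. The segment is cut into `n` pieces, the supergradient
  -- inequality is used at the right end of each, and `G` there is compared with `G a`. The errors
  -- add up to `β K² (1 + 1/n) / 2`, which tends to the claimed remainder.
  have key : ∀ n : ℕ, 0 < n → ∀ k : ℕ,
      Φ a + k * ((n : ℝ)⁻¹ * inner ℝ v (G a)) - β * K ^ 2 * ((n : ℝ)⁻¹) ^ 2 * (k * (k + 1) / 2)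
        ≤ Φ (a + (k * (n : ℝ)⁻¹) • v) := by
    intro n hn k
    have hn0 : (0 : ℝ) ≤ (n : ℝ)⁻¹ := by positivity
    induction k with
    | zero => simp
    | succ k ih =>
      set p := a + (k * (n : ℝ)⁻¹) • v with hp
      set q := a + ((k + 1 : ℕ) * (n : ℝ)⁻¹) • v with hq
      have h1 := hsup q p
      have hpq : p - q = -((n : ℝ)⁻¹ • v) := by
        rw [hp, hq, add_sub_add_left_eq_sub, ← sub_smul, ← neg_smul]
        congr 1
        push_cast; ring
      have hqa : q - a = ((k + 1 : ℕ) * (n : ℝ)⁻¹) • v := by rw [hq]; abel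
      have hqaβ : N (G a - G q) ≤ β * (((k + 1 : ℕ) * (n : ℝ)⁻¹) * K) := by
        have hb : dualNorm N (a - q) = ((k + 1 : ℕ) * (n : ℝ)⁻¹) * K := by
          have : a - q = (-((k + 1 : ℕ) * (n : ℝ)⁻¹)) • v := by rw [neg_smul, ← hqa]; abel
          rw [this, ← coe_dualSeminorm hN, map_smul_eq_mul, norm_neg,
            Real.norm_of_nonneg (by positivity), coe_dualSeminorm]
        rw [← hb]
        exact hlip a q
      have h2 : inner ℝ v (G a) - β * (((k + 1 : ℕ) * (n : ℝ)⁻¹) * K) * K ≤ inner ℝ v (G q) := by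
        have h3 := inner_le_mul_dualNorm hN (G a - G q) v
        have h4 := mul_le_mul_of_nonneg_right hqaβ hK0
        rw [inner_sub_left, real_inner_comm, real_inner_comm v (G q)] at h3
        linarith
      have h5 := mul_le_mul_of_nonneg_left h2 hn0
      rw [hpq, inner_neg_left, real_inner_smul_left] at h1
      push_cast at h5 ⊢
      nlinarith [h5, h1, ih]
  have hlim : Filter.Tendsto (fun n : ℕ => Φ a + inner ℝ v (G a)
      - β * K ^ 2 / 2 * (1 + 1 / (n : ℝ))) Filter.atTop
      (nhds (Φ a + inner ℝ v (G a) - β * K ^ 2 / 2 * (1 + 0))) :=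
    (tendsto_const_nhds.sub
      ((tendsto_const_nhds.add tendsto_one_div_atTop_nhds_zero_nat).const_mul _))
  have hle := le_of_tendsto hlim (b := Φ c) (by
    filter_upwards [Filter.eventually_gt_atTop 0] with n hn
    have h := key n hn n
    have hn' : (n : ℝ) ≠ 0 := by positivity
    have hc : a + ((n : ℝ) * (n : ℝ)⁻¹) • v = c := by
      rw [mul_inv_cancel₀ hn', one_smul, hv]; abel
    rw [hc] at h
    refine le_trans (le_of_eq ?_) h
    field_simp)
  linarith

/-- The descent inequality behind optimistic follow the regularized leader: `p` is the sum of the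
past gradients, `h` is the guess of the next gradient `g`. -/
lemma optimistic_step (hN : ∀ x, N x = 0 → x = 0) (hβ : 0 ≤ β)
    (hsup : ∀ a b, Φ b ≤ Φ a + inner ℝ (b - a) (G a))
    (hlip : ∀ a b, N (G a - G b) ≤ β * dualNorm N (a - b)) (p g h : Vec d) :
    inner ℝ g (G (p + h)) - β / 2 * dualNorm N (g - h) ^ 2
      + 1 / (2 * β) * N (G (p + h) - G p) ^ 2 ≤ Φ (p + g) - Φ p := by
  have h1 := smooth_of_lipschitz_supergradient hN hsup hlip (p + h) (p + g)
  rw [add_sub_add_left_eq_sub] at h1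
  -- The gain comes from the test point `p - r • v`, with `v` norming the increment of `G`.
  -- Smoothness at `p` bounds `Φ` there from below and the supergradient at `p + h` from above.
  -- Together they gain `r δ - β r² / 2`, which `r = δ / β` maximizes.
  obtain ⟨v, hv, hvx⟩ := exists_dualNorm_le_one_inner_eq (N := N) (G (p + h) - G p)
  set δ := N (G (p + h) - G p) with hδ
  set r := δ / β with hr
  have hr0 : 0 ≤ r := div_nonneg (apply_nonneg N _) hβ
  have h2 := smooth_of_lipschitz_supergradient hN hsup hlip p (p - r • v)
  have h3 := hsup (p + h) (p - r • v)
  have e1 : p - r • v - p = -(r • v) := by abel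
  have e2 : p - r • v - (p + h) = -(r • v) - h := by abel
  rw [e1, inner_neg_left, real_inner_smul_left] at h2
  rw [e2, inner_sub_left, inner_neg_left, real_inner_smul_left] at h3
  rw [inner_sub_right] at hvx
  have h4 : dualNorm N (-(r • v)) ≤ r := by
    rw [← coe_dualSeminorm hN, map_neg_eq_map, map_smul_eq_mul, Real.norm_of_nonneg hr0,
      coe_dualSeminorm]
    exact mul_le_of_le_one_right hr0 hv
  have h5 : dualNorm N (-(r • v)) ^ 2 ≤ r ^ 2 := pow_le_pow_left₀ (dualNorm_nonneg hN _) h4 2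
  have h6 := mul_le_mul_of_nonneg_left h5 (by positivity : 0 ≤ β / 2)
  have h7 : r * δ - β / 2 * r ^ 2 = 1 / (2 * β) * δ ^ 2 := by
    -- If `β = 0`, division by zero gives `r = 0` and `1 / (2 * β) = 0`, so both sides vanish.
    rcases hβ.eq_or_lt with hb | hb
    · simp [hr, ← hb]
    · rw [hr]; field_simp; ring
  have h8 : r * inner ℝ v (G (p + h)) - r * inner ℝ v (G p) = r * δ := by rw [← mul_sub, hvx]
  rw [inner_sub_left] at h1
  linarith

/-- Regret of optimistic follow the regularized leader against a fixed comparator value. -/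
lemma optimistic_regret (hN : ∀ x, N x = 0 → x = 0) (hβ : 0 ≤ β)
    (hsup : ∀ a b, Φ b ≤ Φ a + inner ℝ (b - a) (G a))
    (hlip : ∀ a b, N (G a - G b) ≤ β * dualNorm N (a - b)) {x : Vec d} {B : ℝ}
    (hx : ∀ a, Φ a - Φ 0 ≤ inner ℝ a x + B) {T : ℕ} (g h : Fin T → Vec d) :
    ∑ t, inner ℝ (g t) (G (∑ i ∈ Finset.Iio t, g i + h t) - x) ≤ B
      + ∑ t, (β / 2 * dualNorm N (g t - h t) ^ 2
        - 1 / (2 * β) * N (G (∑ i ∈ Finset.Iio t, g i + h t) - G (∑ i ∈ Finset.Iio t, g i)) ^ 2) := by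
  have htel : ∀ {T : ℕ} (g : Fin T → Vec d),
      ∑ t, (Φ (∑ i ∈ Finset.Iio t, g i + g t) - Φ (∑ i ∈ Finset.Iio t, g i))
        = Φ (∑ t, g t) - Φ 0 := by
    intro T g
    induction T with
    | zero => simp
    | succ T ih =>
      have hc : ∀ t : Fin T, ∑ i ∈ Finset.Iio t.castSucc, g i
          = ∑ i ∈ Finset.Iio t, g i.castSucc := by
        intro t
        rw [← Fin.map_castSuccEmb_Iio, Finset.sum_map]; rfl
      have hl : ∑ i ∈ Finset.Iio (Fin.last T), g i = ∑ i : Fin T, g i.castSucc := by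
        rw [Fin.Iio_last_eq_map, Finset.sum_map]; rfl
      rw [Fin.sum_univ_castSucc, hl, Fin.sum_univ_castSucc (f := g)]
      simp only [hc]
      rw [ih fun i => g i.castSucc]
      ring
  have hsum := Finset.sum_le_sum fun t (_ : t ∈ Finset.univ) =>
    optimistic_step hN hβ hsup hlip (∑ i ∈ Finset.Iio t, g i) (g t) (h t)
  rw [htel] at hsum
  have hB := hx (∑ t, g t)
  rw [sum_inner] at hB
  simp only [inner_sub_right, Finset.sum_sub_distrib, Finset.sum_add_distrib] at hsum ⊢
  linarith

end Smoothness

/-! ### Splitting the noise pairs into independent components -/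

section Independence

variable {Ω : Type*} {mΩ : MeasurableSpace Ω} {μ : Measure Ω}

lemma iIndep_bool_of_indep [IsProbabilityMeasure μ] {m : Bool → MeasurableSpace Ω}
    (h : Indep (m true) (m false) μ) : iIndep m μ := by
  rw [iIndep_iff]
  intro s f hf
  set g : Bool → Set Ω := fun b => if b ∈ s then f b else Set.univ with hg
  have hgm : ∀ b, MeasurableSet[m b] (g b) := by
    intro b
    by_cases hb : b ∈ s
    · simpa [hg, hb] using hf b hb
    · simp [hg, hb]
  have h1 : ⋂ i ∈ s, f i = g true ∩ g false := by
    ext ω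
    simp only [Set.mem_iInter, Set.mem_inter_iff, hg]
    constructor
    · intro h
      constructor
      · by_cases hb : true ∈ s <;> simp [hb, h]
      · by_cases hb : false ∈ s <;> simp [hb, h]
    · rintro ⟨ht, hf⟩ b hb
      cases b
      · simpa [hb] using hf
      · simpa [hb] using ht
  have h2 : ∏ i ∈ s, μ (f i) = μ (g true) * μ (g false) := by
    rw [← Fintype.prod_bool (f := fun b => μ (g b)),
      ← Finset.prod_subset (Finset.subset_univ s)]
    · exact Finset.prod_congr rfl fun b hb => by simp [hg, hb]
    · intro b _ hb
      simp [hg, hb]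
  rw [h1, h2]
  exact (Indep_iff _ _ _).1 h _ _ (hgm true) (hgm false)

/-- Splitting each member of an independent family into two independent parts. -/
lemma iIndep_uncurry_bool {ι : Type*} [IsProbabilityMeasure μ] {m : ι → Bool → MeasurableSpace Ω}
    (hle : ∀ i b, m i b ≤ mΩ) (h1 : iIndep (fun i => m i true ⊔ m i false) μ)
    (h2 : ∀ i, Indep (m i true) (m i false) μ) :
    iIndep (fun p : ι × Bool => m p.1 p.2) μ := by
  have hid : ∀ m : MeasurableSpace Ω, m.comap (fun ω => ω) = m := fun m => MeasurableSpace.comap_id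
  -- Identity maps into `Ω` carrying the various σ-algebras translate independence of functions into
  -- independence of σ-algebras.
  have h := iIndepFun_uncurry' (P := μ) (ι := ι) (κ := Bool) (𝓧 := fun _ _ => Ω)
    (m𝓧 := m) (X := fun _ _ ω => ω) (fun i b => measurable_id'' (hle i b)) ?_ ?_
  · rw [iIndepFun_iff_iIndep] at h
    simpa only [hid] using h
  · rw [iIndepFun_iff_iIndep]
    convert h1 using 2 with i
    simp only [MeasurableSpace.pi, iSup_bool_eq, MeasurableSpace.comap_sup,
      MeasurableSpace.comap_comp, Function.comp_def, hid]
  · intro i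
    rw [iIndepFun_iff_iIndep]
    simpa only [hid] using iIndep_bool_of_indep (h2 i)

/-- Independent pairs whose law is a product have, up to null sets, independent measurable
components. -/
lemma exists_independent_components {ι E F : Type*} [Countable ι] [MeasurableSpace E]
    [MeasurableSpace F] [IsProbabilityMeasure μ] {P : Measure E} {Q : Measure F}
    [IsProbabilityMeasure P] [IsProbabilityMeasure Q] {W : ι → Ω → E × F}
    (hlaw : ∀ i, HasLaw (W i) (P.prod Q) μ) (hind : iIndepFun W μ) :
    ∃ (U : ι → Ω → E) (V : ι → Ω → F), (∀ i, Measurable (U i)) ∧ (∀ i, Measurable (V i)) ∧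
      (∀ᵐ ω ∂μ, ∀ i, W i ω = (U i ω, V i ω)) ∧ (∀ i, μ.map (U i) = P) ∧ (∀ i, μ.map (V i) = Q) ∧
      iIndep (fun p : ι × Bool => bif p.2 then MeasurableSpace.comap (U p.1) inferInstance
        else MeasurableSpace.comap (V p.1) inferInstance) μ := by
  have hae : ∀ i, AEMeasurable (W i) μ := fun i => (hlaw i).aemeasurable
  -- `HasLaw` gives only almost everywhere measurability; genuinely measurable versions are needed
  -- to generate sub-σ-algebras.
  set W' : ι → Ω → E × F := fun i => (hae i).mk (W i) with hW'
  have hm : ∀ i, Measurable (W' i) := fun i => (hae i).measurable_mk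
  have heq : ∀ i, W i =ᵐ[μ] W' i := fun i => (hae i).ae_eq_mk
  have hmap : ∀ i, μ.map (W' i) = P.prod Q := fun i => by
    rw [← (hlaw i).map_eq, Measure.map_congr (heq i)]
  have hU : ∀ i, μ.map (fun ω => (W' i ω).1) = P := fun i => by
    have := Measure.map_map (μ := μ) measurable_fst (hm i)
    rw [hmap, Measure.map_fst_prod] at this
    simpa [Function.comp_def] using this.symm
  have hV : ∀ i, μ.map (fun ω => (W' i ω).2) = Q := fun i => by
    have := Measure.map_map (μ := μ) measurable_snd (hm i)
    rw [hmap, Measure.map_snd_prod] at this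
    simpa [Function.comp_def] using this.symm
  refine ⟨fun i ω => (W' i ω).1, fun i ω => (W' i ω).2, fun i => (hm i).fst, fun i => (hm i).snd,
    ae_all_iff.2 heq, hU, hV, ?_⟩
  refine iIndep_uncurry_bool (m := fun i b => bif b
    then MeasurableSpace.comap (fun ω => (W' i ω).1) inferInstance
    else MeasurableSpace.comap (fun ω => (W' i ω).2) inferInstance) ?_ ?_ ?_
  · rintro i (_ | _)
    · exact (hm i).snd.comap_le
    · exact (hm i).fst.comap_le
  · have h := (iIndepFun_iff_iIndep _ _ _).1 ((iIndepFun_congr heq).1 hind)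
    convert h using 2 with i
    exact (MeasurableSpace.comap_prodMk _ _).symm
  · intro i
    have h : IndepFun (fun ω => (W' i ω).1) (fun ω => (W' i ω).2) μ := by
      rw [indepFun_iff_map_prod_eq_prod_map_map (hm i).fst.aemeasurable (hm i).snd.aemeasurable,
        hU, hV]
      exact hmap i
    exact (IndepFun_iff_Indep _ _ _).1 h

end Independence

/-! ### Conditional expectation of one oracle answer -/

section Centering

/-- The selection of minimizers is known only to be Borel, so the outer map cannot be required to be
continuous. -/
lemma MeasureTheory.AEStronglyMeasurable.measurable_comp {E F : Type*} [TopologicalSpace E]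
    [TopologicalSpace.PseudoMetrizableSpace E] [MeasurableSpace E] [BorelSpace E]
    [TopologicalSpace F] [TopologicalSpace.PseudoMetrizableSpace F] [MeasurableSpace F]
    [OpensMeasurableSpace F] [SecondCountableTopology F]
    {Ω : Type*} {m mΩ : MeasurableSpace Ω} {μ : Measure Ω} {q : Ω → E} (hq : AEStronglyMeasurable[m] q μ) {φ : E → F}
    (hφ : Measurable φ) : AEStronglyMeasurable[m] (fun ω => φ (q ω)) μ :=
  ⟨fun ω => φ (hq.mk q ω),
    (hφ.comp hq.stronglyMeasurable_mk.measurable).stronglyMeasurable,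
    hq.ae_eq_mk.fun_comp φ⟩

variable {d : ℕ} {Ω : Type*} {m₁ m₂ m₃ : MeasurableSpace Ω} {mΩ : MeasurableSpace Ω} {μ : Measure Ω} [IsProbabilityMeasure μ]
  {X : Set (Vec d)} {P : Measure (Vec d)}

/-- The joint law of a variable measurable with respect to `m₁` and one which is independent
of `m₁`. -/
lemma map_prodMk_of_indep {E F : Type*} [MeasurableSpace E] [MeasurableSpace F]
    (h₁ : m₁ ≤ mΩ) (h₂ : m₂ ≤ mΩ) (hind : Indep m₁ m₂ μ)
    {U : Ω → E} (hU : Measurable[m₁] U) {V : Ω → F} (hV : Measurable[m₂] V) :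
    μ.map (fun ω => (U ω, V ω)) = (μ.map U).prod (μ.map V) := by
  refine (indepFun_iff_map_prod_eq_prod_map_map (hU.mono h₁ le_rfl).aemeasurable
    (hV.mono h₂ le_rfl).aemeasurable).1 ?_
  exact (IndepFun_iff_Indep _ _ _).2
    (indep_of_indep_of_le_left (indep_of_indep_of_le_right hind hV.comap_le) hU.comap_le)

/-- If the noise is independent of the linear objective then the minimizer is almost surely
unique. -/
lemma argmin_ae_eq_selection [SFinite P] (hP : P ≪ volume) {S : Vec d → Vec d}
    (hSu : ∀ᵐ g ∂(volume : Measure (Vec d)), ∀ x, IsLinearArgmin X g x → x = S g)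
    (h₁ : m₁ ≤ mΩ) (h₂ : m₂ ≤ mΩ) (hind : Indep m₁ m₂ μ)
    {q σ z : Ω → Vec d} (hq : AEStronglyMeasurable[m₁] q μ) (hσ : Measurable[m₂] σ)
    (hlaw : μ.map σ = P) (hz : ∀ᵐ ω ∂μ, IsLinearArgmin X (q ω - σ ω) (z ω)) :
    z =ᵐ[μ] fun ω => S (q ω - σ ω) := by
  set q' := hq.mk q with hq'
  have hq'm : Measurable[m₁] q' := hq.stronglyMeasurable_mk.measurable
  -- `B` is a measurable null set containing all objectives where `S` may fail. By independence the
  -- law of `(q, σ)` is a product, and each slice of the event `q - σ ∈ B` is null.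
  set B := toMeasurable (volume : Measure (Vec d)) {g | ¬ ∀ x, IsLinearArgmin X g x → x = S g}
    with hB
  have hB0 : volume B = 0 := by rw [hB, measure_toMeasurable]; exact hSu
  have hBm : MeasurableSet B := measurableSet_toMeasurable _ _
  have hsub : Measurable fun p : Vec d × Vec d => p.1 - p.2 := measurable_fst.sub measurable_snd
  have hnull : ((μ.map q').prod P) ((fun p : Vec d × Vec d => p.1 - p.2) ⁻¹' B) = 0 := by
    refine Measure.measure_prod_null_of_ae_null (hsub hBm)
      (Filter.Eventually.of_forall fun a => ?_)
    have h := ae_sub_left hP (p := fun g => g ∉ B) (measure_eq_zero_iff_ae_notMem.1 hB0) a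
    exact measure_eq_zero_iff_ae_notMem.2 h
  rw [← hlaw, ← map_prodMk_of_indep h₁ h₂ hind hq'm hσ,
    Measure.map_apply ((hq'm.mono h₁ le_rfl).prodMk (hσ.mono h₂ le_rfl)) (hsub hBm)] at hnull
  filter_upwards [measure_eq_zero_iff_ae_notMem.1 hnull, hq.ae_eq_mk, hz] with ω h1 h2 h3
  have h4 : q ω - σ ω ∉ B := by rw [h2]; exact h1
  by_contra hne
  exact h4 (subset_toMeasurable _ _ fun hall => hne (hall _ h3))

lemma measurable_gradPhi [SFinite P] (hX : IsCompact X) (hXn : X.Nonempty) (hP : P ≪ volume) :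
    Measurable (gradPhi X P) := by
  obtain ⟨S, hS, hSX, hSu⟩ := exists_measurable_argmin hX hXn
  have h : gradPhi X P = fun g => ∫ σ, S (g - σ) ∂P := by
    ext1 g; exact gradPhi_eq_integral hX hXn hP hSu g
  rw [h]
  have hm : Measurable fun p : Vec d × Vec d => S (p.1 - p.2) :=
    hS.comp (measurable_fst.sub measurable_snd)
  exact hm.stronglyMeasurable.integral_prod_right.measurable

/-- The oracle answer has conditional expectation `∇Φ(q)` given `q`. -/
lemma integral_inner_argmin_sub_gradPhi [IsProbabilityMeasure P] (hX : IsCompact X) (hXn : X.Nonempty) (hP : P ≪ volume)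
    (h₁ : m₁ ≤ mΩ) (h₂ : m₂ ≤ mΩ) (hind : Indep m₁ m₂ μ)
    {q σ z R : Ω → Vec d} (hq : AEStronglyMeasurable[m₁] q μ) (hσ : Measurable[m₂] σ)
    (hlaw : μ.map σ = P) (hz : ∀ᵐ ω ∂μ, IsLinearArgmin X (q ω - σ ω) (z ω))
    (hR : AEStronglyMeasurable[m₁] R μ) {B : ℝ} (hB : ∀ᵐ ω ∂μ, ‖R ω‖ ≤ B) :
    ∫ ω, inner ℝ (R ω) (z ω - gradPhi X P (q ω)) ∂μ = 0 := by
  obtain ⟨S, hS, hSX, hSu⟩ := exists_measurable_argmin hX hXn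
  obtain ⟨K, hK⟩ := hX.isBounded.exists_norm_le
  have hzS := argmin_ae_eq_selection hP hSu h₁ h₂ hind hq hσ hlaw hz
  set q' := hq.mk q with hq'
  set R' := hR.mk R with hR'
  have hq'm : Measurable[m₁] q' := hq.stronglyMeasurable_mk.measurable
  have hR'm : Measurable[m₁] R' := hR.stronglyMeasurable_mk.measurable
  have hUm : Measurable[m₁] fun ω => (q' ω, R' ω) := hq'm.prodMk hR'm
  -- The integrand becomes a function of `((q, R), σ)`, whose law is a product; for fixed `(q, R)`
  -- the inner integral over `σ` vanishes by the definition of `gradPhi`.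
  set F : (Vec d × Vec d) × Vec d → ℝ :=
    fun p => inner ℝ p.1.2 (S (p.1.1 - p.2) - gradPhi X P p.1.1) with hF
  have hFm : Measurable F := by
    refine measurable_fst.snd.inner ((hS.comp (measurable_fst.fst.sub measurable_snd)).sub ?_)
    exact (measurable_gradPhi hX hXn hP).comp measurable_fst.fst
  have hVm : Measurable fun ω => ((q' ω, R' ω), σ ω) :=
    (hUm.mono h₁ le_rfl).prodMk (hσ.mono h₂ le_rfl)
  have hbound : ∀ a, ‖gradPhi X P a‖ ≤ K := fun a => by
    rw [gradPhi_eq_integral hX hXn hP hSu]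
    refine (norm_integral_le_of_norm_le_const
      (Filter.Eventually.of_forall fun σ => hK _ (hSX _))).trans ?_
    simp
  have hint : Integrable (fun ω => F ((q' ω, R' ω), σ ω)) μ := by
    refine Integrable.of_bound (hFm.comp hVm).aestronglyMeasurable (B * (K + K)) ?_
    filter_upwards [hB, hR.ae_eq_mk] with ω h1 h2
    refine (norm_inner_le_norm _ _).trans ?_
    rw [h2] at h1
    exact mul_le_mul h1 ((norm_sub_le _ _).trans (add_le_add (hK _ (hSX _)) (hbound _)))
      (norm_nonneg _) ((norm_nonneg _).trans h1)
  have h1 : ∫ ω, inner ℝ (R ω) (z ω - gradPhi X P (q ω)) ∂μ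
      = ∫ ω, F ((q' ω, R' ω), σ ω) ∂μ := by
    refine integral_congr_ae ?_
    filter_upwards [hzS, hq.ae_eq_mk, hR.ae_eq_mk] with ω e1 e2 e3
    simp only [hF]
    rw [e1, e2, e3]
  have hlaw2 := map_prodMk_of_indep h₁ h₂ hind hUm hσ
  rw [hlaw] at hlaw2
  have hintp : Integrable F ((μ.map fun ω => (q' ω, R' ω)).prod P) := by
    rw [← hlaw2, integrable_map_measure hFm.aestronglyMeasurable hVm.aemeasurable]
    exact hint
  have : IsProbabilityMeasure (μ.map fun ω => (q' ω, R' ω)) :=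
    Measure.isProbabilityMeasure_map (hUm.mono h₁ le_rfl).aemeasurable
  rw [h1, ← integral_map hVm.aemeasurable hFm.aestronglyMeasurable (f := F), hlaw2,
    integral_prod _ hintp]
  refine integral_eq_zero_of_ae (Filter.Eventually.of_forall fun p => ?_)
  have hSi : Integrable (fun s => S (p.1 - s)) P :=
    Integrable.of_bound (hS.comp (measurable_const.sub measurable_id)).aestronglyMeasurable K
      (Filter.Eventually.of_forall fun s => hK _ (hSX _))
  have h2 : ∫ s, F (p, s) ∂P = inner ℝ p.2 (∫ s, (S (p.1 - s) - gradPhi X P p.1) ∂P) :=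
    integral_inner (𝕜 := ℝ) (f := fun s => S (p.1 - s) - gradPhi X P p.1)
      (hSi.sub (integrable_const _)) p.2
  change ∫ s, F (p, s) ∂P = 0
  rw [h2, integral_sub hSi (integrable_const _), ← gradPhi_eq_integral hX hXn hP hSu]
  simp

/-- The oracle answer is measurable with respect to the objective and the noise. -/
lemma aestronglyMeasurable_argmin [SFinite P] (hX : IsCompact X) (hXn : X.Nonempty) (hP : P ≪ volume)
    (h₁ : m₁ ≤ mΩ) (h₂ : m₂ ≤ mΩ) (hind : Indep m₁ m₂ μ)
    {q σ z : Ω → Vec d} (hq : AEStronglyMeasurable[m₁] q μ) (hσ : Measurable[m₂] σ)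
    (hlaw : μ.map σ = P) (hz : ∀ᵐ ω ∂μ, IsLinearArgmin X (q ω - σ ω) (z ω))
    (h₁₃ : m₁ ≤ m₃) (h₂₃ : m₂ ≤ m₃) : AEStronglyMeasurable[m₃] z μ := by
  obtain ⟨S, hS, hSX, hSu⟩ := exists_measurable_argmin hX hXn
  have h := argmin_ae_eq_selection hP hSu h₁ h₂ hind hq hσ hlaw hz
  refine AEStronglyMeasurable.congr ?_ h.symm
  have hs : AEStronglyMeasurable[m₃] σ μ :=
    ((hσ.mono h₂₃ le_rfl).stronglyMeasurable).aestronglyMeasurable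
  exact ((hq.mono h₁₃).sub hs).measurable_comp hS

end Centering

/-! ### Averages of conditionally independent oracle answers -/

section Mean

lemma vecMean_sub {d m : ℕ} (hm : 0 < m) (v : Fin m → Vec d) (a : Vec d) :
    vecMean v - a = (m : ℝ)⁻¹ • ∑ j, (v j - a) := by
  have hm' : (m : ℝ) ≠ 0 := by positivity
  rw [vecMean, Finset.sum_sub_distrib, Finset.sum_const, Finset.card_univ, Fintype.card_fin,
    smul_sub, ← Nat.cast_smul_eq_nsmul ℝ, smul_smul, inv_mul_cancel₀ hm', one_smul]

lemma vecMean_mem {d m : ℕ} (hm : 0 < m) {X : Set (Vec d)} (hX : Convex ℝ X) {v : Fin m → Vec d}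
    (hv : ∀ j, v j ∈ X) : vecMean v ∈ X := by
  rw [vecMean, Finset.smul_sum]
  refine hX.sum_mem (fun _ _ => by positivity) ?_ fun j _ => hv j
  have hm' : (m : ℝ) ≠ 0 := by positivity
  simp [hm']

variable {d m : ℕ} {Ω : Type*} {m₁ m₂ m₃ : MeasurableSpace Ω} {mΩ : MeasurableSpace Ω}
  {μ : Measure Ω}

lemma aestronglyMeasurable_sum_vec {ι : Type*} (s : Finset ι) {z : ι → Ω → Vec d}
    (hz : ∀ i ∈ s, AEStronglyMeasurable[m₁] (z i) μ) :
    AEStronglyMeasurable[m₁] (fun ω => ∑ i ∈ s, z i ω) μ := by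
  classical
  induction s using Finset.induction_on with
  | empty => simpa using aestronglyMeasurable_const
  | insert i s hi ih =>
    simp only [Finset.sum_insert hi]
    exact (hz i (Finset.mem_insert_self i s)).add
      (ih fun j hj => hz j (Finset.mem_insert_of_mem hj))

lemma aestronglyMeasurable_vecMean {z : Fin m → Ω → Vec d}
    (hz : ∀ j, AEStronglyMeasurable[m₁] (z j) μ) :
    AEStronglyMeasurable[m₁] (fun ω => vecMean fun j => z j ω) μ := by
  exact AEStronglyMeasurable.const_smul
    (aestronglyMeasurable_sum_vec Finset.univ fun j _ => hz j) (m : ℝ)⁻¹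

variable [IsProbabilityMeasure μ]
  {X : Set (Vec d)} {P : Measure (Vec d)} [IsProbabilityMeasure P]

/-- The average of `m` oracle answers is unbiased. -/
lemma integral_inner_vecMean_sub_gradPhi (hm : 0 < m) (hX : IsCompact X) (hXn : X.Nonempty)
    (hP : P ≪ volume) {mσ : Fin m → MeasurableSpace Ω} (h₁ : m₁ ≤ mΩ) (hle : ∀ j, mσ j ≤ mΩ)
    (hind : ∀ j, Indep m₁ (mσ j) μ) {q R : Ω → Vec d} {σ z : Fin m → Ω → Vec d}
    (hq : AEStronglyMeasurable[m₁] q μ) (hσ : ∀ j, Measurable[mσ j] (σ j))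
    (hlaw : ∀ j, μ.map (σ j) = P) (hz : ∀ j, ∀ᵐ ω ∂μ, IsLinearArgmin X (q ω - σ j ω) (z j ω))
    (hR : AEStronglyMeasurable[m₁] R μ) {B : ℝ} (hB : ∀ᵐ ω ∂μ, ‖R ω‖ ≤ B) :
    ∫ ω, inner ℝ (R ω) ((vecMean fun j => z j ω) - gradPhi X P (q ω)) ∂μ = 0 := by
  obtain ⟨K, hK⟩ := hX.isBounded.exists_norm_le
  have hzm : ∀ j, AEStronglyMeasurable (z j) μ := fun j =>
    aestronglyMeasurable_argmin hX hXn hP h₁ (hle j) (hind j) hq (hσ j) (hlaw j) (hz j) h₁ (hle j)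
  have hgm : AEStronglyMeasurable (fun ω => gradPhi X P (q ω)) μ :=
    (hq.mono h₁).measurable_comp (measurable_gradPhi hX hXn hP)
  have hgK : ∀ g, ‖gradPhi X P g‖ ≤ K := fun g => by
    refine (norm_integral_le_of_norm_le_const
      (Filter.Eventually.of_forall fun σ => hK _ (linearArgmin_spec hX hXn _).1)).trans ?_
    simp
  have hint : ∀ j, Integrable (fun ω => (inner ℝ (R ω) (z j ω - gradPhi X P (q ω)) : ℝ)) μ := by
    intro j
    refine Integrable.of_bound ((hR.mono h₁).inner ((hzm j).sub hgm)) (B * (K + K)) ?_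
    filter_upwards [hB, hz j] with ω h1 h2
    exact (norm_inner_le_norm _ _).trans (mul_le_mul h1
      ((norm_sub_le _ _).trans (add_le_add (hK _ h2.1) (hgK _)))
      (norm_nonneg _) ((norm_nonneg _).trans h1))
  have h : ∀ ω, (inner ℝ (R ω) ((vecMean fun j => z j ω) - gradPhi X P (q ω)) : ℝ)
      = (m : ℝ)⁻¹ * ∑ j, inner ℝ (R ω) (z j ω - gradPhi X P (q ω)) := fun ω => by
    rw [vecMean_sub hm, real_inner_smul_right, inner_sum]
  simp only [h]
  rw [integral_const_mul, integral_finsetSum _ fun j _ => hint j]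
  simp [integral_inner_argmin_sub_gradPhi hX hXn hP h₁ (hle _) (hind _) hq (hσ _) (hlaw _) (hz _)
    hR hB]

/-- The average of `m` conditionally independent oracle answers has variance `O(1 / m)`. -/
lemma integral_norm_vecMean_sub_gradPhi_sq_le (hm : 0 < m) (hX : IsCompact X) (hXc : Convex ℝ X)
    (hXn : X.Nonempty) (hP : P ≪ volume) {mσ : Fin m → MeasurableSpace Ω} (h₁ : m₁ ≤ mΩ)
    (hle : ∀ j, mσ j ≤ mΩ) (hind : ∀ j, Indep m₁ (mσ j) μ)
    (hind' : ∀ j k, j ≠ k → Indep (m₁ ⊔ mσ k) (mσ j) μ) {q : Ω → Vec d} {σ z : Fin m → Ω → Vec d}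
    (hq : AEStronglyMeasurable[m₁] q μ) (hσ : ∀ j, Measurable[mσ j] (σ j))
    (hlaw : ∀ j, μ.map (σ j) = P) (hz : ∀ j, ∀ᵐ ω ∂μ, IsLinearArgmin X (q ω - σ j ω) (z j ω))
    {B : ℝ} (hB : ∀ x ∈ X, ∀ y ∈ X, ‖x - y‖ ≤ B) :
    ∫ ω, ‖(vecMean fun j => z j ω) - gradPhi X P (q ω)‖ ^ 2 ∂μ ≤ B ^ 2 / m := by
  have hgrad := gradPhi_mem hX hXc hXn hP
  set w : Fin m → Ω → Vec d := fun j ω => z j ω - gradPhi X P (q ω) with hw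
  have hzm : ∀ j, AEStronglyMeasurable[m₁ ⊔ mσ j] (z j) μ := fun j =>
    aestronglyMeasurable_argmin hX hXn hP h₁ (hle j) (hind j) hq (hσ j) (hlaw j) (hz j)
      le_sup_left le_sup_right
  have hwm : ∀ j, AEStronglyMeasurable[m₁ ⊔ mσ j] (w j) μ := fun j =>
    (hzm j).sub ((hq.measurable_comp (measurable_gradPhi hX hXn hP)).mono le_sup_left)
  have hwm' : ∀ j, AEStronglyMeasurable (w j) μ := fun j => (hwm j).mono (sup_le h₁ (hle j))
  have hwB : ∀ j, ∀ᵐ ω ∂μ, ‖w j ω‖ ≤ B := fun j => by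
    filter_upwards [hz j] with ω hω
    exact hB _ hω.1 _ (hgrad _)
  have hint : ∀ j k, Integrable (fun ω => (inner ℝ (w k ω) (w j ω) : ℝ)) μ := fun j k => by
    refine Integrable.of_bound ((hwm' k).inner (hwm' j)) (B * B) ?_
    filter_upwards [hwB j, hwB k] with ω h1 h2
    exact (norm_inner_le_norm _ _).trans
      (mul_le_mul h2 h1 (norm_nonneg _) ((norm_nonneg _).trans h1))
  -- Cross terms vanish: `w k` is measurable with respect to the past and the `k`-th noise, so it
  -- serves as the multiplier `R` against the independent `j`-th sample.
  have hoff : ∀ j k, j ≠ k → ∫ ω, (inner ℝ (w k ω) (w j ω) : ℝ) ∂μ = 0 := fun j k hjk =>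
    integral_inner_argmin_sub_gradPhi hX hXn hP (sup_le h₁ (hle k)) (hle j) (hind' j k hjk)
      (hq.mono le_sup_left) (hσ j) (hlaw j) (hz j) (hwm k) (hwB k)
  have hdiag : ∀ j, ∫ ω, (inner ℝ (w j ω) (w j ω) : ℝ) ∂μ ≤ B ^ 2 := fun j => by
    have h : ∫ ω, (inner ℝ (w j ω) (w j ω) : ℝ) ∂μ ≤ ∫ _, B ^ 2 ∂μ := by
      refine integral_mono_ae (hint j j) (integrable_const _) ?_
      filter_upwards [hwB j] with ω h1
      rw [real_inner_self_eq_norm_sq]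
      exact pow_le_pow_left₀ (norm_nonneg _) h1 2
    simpa using h
  have hm' : (0 : ℝ) < m := by positivity
  have hexp : ∀ ω, ‖(vecMean fun j => z j ω) - gradPhi X P (q ω)‖ ^ 2
      = ((m : ℝ)⁻¹) ^ 2 * ∑ j, ∑ k, inner ℝ (w k ω) (w j ω) := fun ω => by
    rw [vecMean_sub hm, norm_smul, mul_pow, Real.norm_of_nonneg (by positivity),
      ← real_inner_self_eq_norm_sq, inner_sum]
    simp only [sum_inner, hw]
  simp only [hexp]
  rw [integral_const_mul, integral_finsetSum _ fun j _ => integrable_finsetSum _ fun k _ =>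
    hint j k]
  have hsum : ∀ j, ∫ ω, ∑ k, (inner ℝ (w k ω) (w j ω) : ℝ) ∂μ ≤ B ^ 2 := fun j => by
    rw [integral_finsetSum _ fun k _ => hint j k, Finset.sum_eq_single j]
    · exact hdiag j
    · intro k _ hk
      exact hoff j k hk.symm
    · simp
  calc ((m : ℝ)⁻¹) ^ 2 * ∑ j, ∫ ω, ∑ k, (inner ℝ (w k ω) (w j ω) : ℝ) ∂μ
      ≤ ((m : ℝ)⁻¹) ^ 2 * ∑ _j : Fin m, B ^ 2 :=
        mul_le_mul_of_nonneg_left (Finset.sum_le_sum fun j _ => hsum j) (by positivity)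
    _ = B ^ 2 / m := by
        rw [Finset.sum_const, Finset.card_univ, Fintype.card_fin, nsmul_eq_mul]
        field_simp

end Mean

/-! ### Moments below the second -/

section Moments

variable {Ω : Type*} {mΩ : MeasurableSpace Ω} {μ : Measure Ω} [IsProbabilityMeasure μ]

/-- Lyapunov's inequality for exponents at most two. -/
lemma integral_rpow_le_of_integral_sq_le {w : Ω → ℝ} (hw0 : ∀ ω, 0 ≤ w ω)
    (hwm : AEStronglyMeasurable w μ) {K : ℝ} (hK : ∀ᵐ ω ∂μ, w ω ≤ K) {s : ℝ} (hs : 0 ≤ s)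
    (hsq : ∫ ω, w ω ^ 2 ∂μ ≤ s ^ 2) {p : ℝ} (hp0 : 0 ≤ p) (hp2 : p ≤ 2) :
    Integrable (fun ω => w ω ^ p) μ ∧ ∫ ω, w ω ^ p ∂μ ≤ s ^ p := by
  have hint : ∀ r : ℝ, 0 ≤ r → Integrable (fun ω => w ω ^ r) μ := fun r hr => by
    refine Integrable.of_bound ?_ (K ^ r) ?_
    · exact (Real.continuous_rpow_const hr).comp_aestronglyMeasurable hwm
    · filter_upwards [hK] with ω h
      rw [Real.norm_of_nonneg (Real.rpow_nonneg (hw0 ω) r)]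
      exact Real.rpow_le_rpow (hw0 ω) h hr
  refine ⟨hint p hp0, ?_⟩
  have hpow : ∀ x : ℝ, 0 ≤ x → (x ^ 2) ^ (p / 2) = x ^ p := fun x hx => by
    rw [← Real.rpow_natCast, ← Real.rpow_mul hx]
    congr 1
    push_cast; ring
  have hsqi : Integrable (fun ω => w ω ^ 2) μ := by simpa using hint 2 (by norm_num)
  have hpi : Integrable (fun ω => (w ω ^ 2) ^ (p / 2)) μ := by
    simpa only [hpow _ (hw0 _)] using hint p hp0
  -- Jensen's inequality for the concave function `t ↦ t ^ (p / 2)` applied to `w ^ 2`.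
  have h := (Real.concaveOn_rpow (p := p / 2) (by linarith) (by linarith)).le_map_integral
    (Real.continuous_rpow_const (by linarith)).continuousOn isClosed_Ici
    (Filter.Eventually.of_forall fun ω => sq_nonneg (w ω)) hsqi hpi
  simp only [hpow _ (hw0 _)] at h
  refine h.trans ?_
  rw [← hpow s hs]
  exact Real.rpow_le_rpow (integral_nonneg fun ω => sq_nonneg (w ω)) hsq (by linarith)

end Moments

/-! ### Predictions from fresh samples -/

section Prediction

variable {d m : ℕ} {Ω κ : Type*} {mΩ : MeasurableSpace Ω} {μ : Measure Ω} [IsProbabilityMeasure μ]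
  {X : Set (Vec d)} {P : Measure (Vec d)} [IsProbabilityMeasure P]

/-- A prediction from `m` fresh samples: it is measurable with respect to the past and the samples,
its variance is `O(1 / m)`, and it is unbiased given everything except the samples. -/
lemma prediction_of_fresh_samples (hm : 0 < m) (hX : IsCompact X) (hXc : Convex ℝ X)
    (hXn : X.Nonempty) (hP : P ≪ volume) {mF : κ → MeasurableSpace Ω} (hle : ∀ p, mF p ≤ mΩ)
    (hind : iIndep mF μ) {I : Set κ} {p : Fin m → κ} (hp : Function.Injective p)
    (hpI : ∀ j, p j ∉ I) {q : Ω → Vec d} {σ z : Fin m → Ω → Vec d}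
    (hq : AEStronglyMeasurable[⨆ i ∈ I, mF i] q μ) (hσ : ∀ j, Measurable[mF (p j)] (σ j))
    (hlaw : ∀ j, μ.map (σ j) = P) (hz : ∀ j, ∀ᵐ ω ∂μ, IsLinearArgmin X (q ω - σ j ω) (z j ω))
    {B : ℝ} (hB : ∀ x ∈ X, ∀ y ∈ X, ‖x - y‖ ≤ B) :
    (∀ J, I ⊆ J → (∀ j, p j ∈ J) →
      AEStronglyMeasurable[⨆ i ∈ J, mF i] (fun ω => vecMean fun j => z j ω) μ) ∧
    ∫ ω, ‖(vecMean fun j => z j ω) - gradPhi X P (q ω)‖ ^ 2 ∂μ ≤ B ^ 2 / m ∧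
    ∀ J, I ⊆ J → (∀ j, p j ∉ J) → ∀ (R : Ω → Vec d) (K : ℝ),
      AEStronglyMeasurable[⨆ i ∈ J, mF i] R μ → (∀ ω, ‖R ω‖ ≤ K) →
      ∫ ω, inner ℝ (R ω) ((vecMean fun j => z j ω) - gradPhi X P (q ω)) ∂μ = 0 := by
  have hFle : ∀ J : Set κ, (⨆ i ∈ J, mF i) ≤ mΩ := fun J => iSup₂_le fun i _ => hle i
  have hindep : ∀ (J : Set κ) (i : κ), i ∉ J → Indep (⨆ i ∈ J, mF i) (mF i) μ := by
    intro J i hi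
    have h := indep_iSup_of_disjoint hle hind (S := J) (T := {i})
      (Set.disjoint_singleton_right.2 hi)
    simpa using h
  have hmono : ∀ {J J' : Set κ}, J ⊆ J' → (⨆ i ∈ J, mF i) ≤ ⨆ i ∈ J', mF i :=
    fun h => biSup_mono h
  have hsingle : ∀ {J : Set κ} {i : κ}, i ∈ J → mF i ≤ ⨆ i ∈ J, mF i :=
    fun {J i} h => le_iSup₂ (f := fun i (_ : i ∈ J) => mF i) i h
  refine ⟨fun J hIJ hpJ => ?_, ?_, fun J hIJ hpJ R K hR hK => ?_⟩
  · exact aestronglyMeasurable_vecMean fun j =>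
      aestronglyMeasurable_argmin hX hXn hP (hFle I) (hle (p j)) (hindep I _ (hpI j)) hq (hσ j)
        (hlaw j) (hz j) (hmono hIJ) (hsingle (hpJ j))
  · refine integral_norm_vecMean_sub_gradPhi_sq_le hm hX hXc hXn hP (hFle I) (fun j => hle (p j))
      (fun j => hindep I _ (hpI j)) (fun j k hjk => ?_) hq hσ hlaw hz hB
    refine indep_of_indep_of_le_left (hindep (insert (p k) I) (p j) ?_)
      (sup_le (hmono (Set.subset_insert _ _)) (hsingle (Set.mem_insert _ _)))
    rintro (h | h)
    · exact hjk (hp h)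
    · exact hpI j h
  · exact integral_inner_vecMean_sub_gradPhi hm hX hXn hP (hFle J) (fun j => hle (p j))
      (fun j => hindep J _ (hpJ j)) (hq.mono (hmono hIJ)) hσ hlaw hz hR
      (Filter.Eventually.of_forall hK)

end Prediction

/-- The gradients are controlled only on `X ×ˢ Y`; a measurable extension to the whole space can be
composed with almost everywhere measurable representatives. -/
lemma aestronglyMeasurable_of_measurable_restrict {d₁ d₂ d : ℕ} {Ω : Type*}
    {m mΩ : MeasurableSpace Ω} {μ : Measure Ω} {X : Set (Vec d₁)} {Y : Set (Vec d₂)}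
    (hX : IsClosed X) (hY : IsClosed Y) {g : Vec d₁ → Vec d₂ → Vec d}
    (hg : Measurable fun z : ↥(X ×ˢ Y) => g z.1.1 z.1.2) {x : Ω → Vec d₁} {y : Ω → Vec d₂}
    (hx : AEStronglyMeasurable[m] x μ) (hy : AEStronglyMeasurable[m] y μ)
    (hxX : ∀ ω, x ω ∈ X) (hyY : ∀ ω, y ω ∈ Y) :
    AEStronglyMeasurable[m] (fun ω => g (x ω) (y ω)) μ := by
  obtain ⟨G, hG, hGg⟩ := (MeasurableEmbedding.subtype_coe
    (hX.measurableSet.prod hY.measurableSet)).exists_measurable_extend hg fun _ => ⟨0⟩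
  have hxy : AEStronglyMeasurable[m] (fun ω => (x ω, y ω)) μ := hx.prodMk hy
  have h := hxy.measurable_comp hG
  refine h.congr (Filter.Eventually.of_forall fun ω => ?_)
  exact congrFun hGg ⟨(x ω, y ω), hxX ω, hyY ω⟩

instance : Finite Stage :=
  Finite.of_surjective (fun b : Bool => bif b then Stage.guess else Stage.act) fun s => by
    cases s
    · exact ⟨true, rfl⟩
    · exact ⟨false, rfl⟩

/-! ### Exchange of the players, and the play as an adapted process -/

namespace OFTPLPlay

variable {d₁ d₂ : ℕ} {Ω : Type*} [MeasurableSpace Ω] {μ : Measure Ω}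
  {X : Set (Vec d₁)} {Y : Set (Vec d₂)}
  {gx : Vec d₁ → Vec d₂ → Vec d₁} {gy : Vec d₁ → Vec d₂ → Vec d₂}
  {P₁ : Measure (Vec d₁)} {P₂ : Measure (Vec d₂)} {T m : ℕ}

/-- The same play seen with the roles of the players exchanged. -/
def swap [SFinite P₁] [SFinite P₂] (A : OFTPLPlay μ X Y gx gy P₁ P₂ T m) :
    OFTPLPlay μ Y X (fun y x => -gy x y) (fun y x => -gx x y) P₂ P₁ T m where
  noise s t j ω := (A.noise s t j ω).swap
  noise_law s t j := by
    refine ⟨measurable_swap.comp_aemeasurable (A.noise_law s t j).aemeasurable, ?_⟩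
    have h := AEMeasurable.map_map_of_aemeasurable (μ := μ) (f := A.noise s t j) (g := Prod.swap)
      measurable_swap.aemeasurable (A.noise_law s t j).aemeasurable
    rw [(A.noise_law s t j).map_eq, Measure.prod_swap] at h
    exact h.symm
  noise_indep := A.noise_indep.comp (fun _ => Prod.swap) fun _ => measurable_swap
  xGuess := A.yGuess
  yGuess := A.xGuess
  xAct := A.yAct
  yAct := A.xAct
  xGuess_spec t j ω := by
    refine ⟨(A.yGuess_spec t j ω).1, fun z hz => ?_⟩
    have h := (A.yGuess_spec t j ω).2 z hz
    simp only [Prod.fst_swap, Finset.sum_neg_distrib, inner_sub_left, inner_neg_left,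
      inner_add_left] at h ⊢
    linarith
  yGuess_spec t j ω := by
    refine ⟨(A.xGuess_spec t j ω).1, fun z hz => ?_⟩
    have h := (A.xGuess_spec t j ω).2 z hz
    simp only [Prod.snd_swap, Finset.sum_neg_distrib, inner_sub_left, inner_neg_left,
      inner_add_left] at h ⊢
    linarith
  xAct_spec t j ω := by
    refine ⟨(A.yAct_spec t j ω).1, fun z hz => ?_⟩
    have h := (A.yAct_spec t j ω).2 z hz
    simp only [Prod.fst_swap, Finset.sum_neg_distrib, inner_sub_left, inner_neg_left,
      inner_add_left] at h ⊢
    linarith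
  yAct_spec t j ω := by
    refine ⟨(A.xAct_spec t j ω).1, fun z hz => ?_⟩
    have h := (A.xAct_spec t j ω).2 z hz
    simp only [Prod.snd_swap, Finset.sum_neg_distrib, inner_sub_left, inner_neg_left,
      inner_add_left] at h ⊢
    linarith

/-- The prediction of the minimizing player's action with zero guess. -/
def xPred (A : OFTPLPlay μ X Y gx gy P₁ P₂ T m) (t : Fin T) (ω : Ω) : Vec d₁ :=
  vecMean fun j => A.xGuess t j ω

/-- The prediction of the maximizing player's action with zero guess. -/
def yPred (A : OFTPLPlay μ X Y gx gy P₁ P₂ T m) (t : Fin T) (ω : Ω) : Vec d₂ :=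
  vecMean fun j => A.yGuess t j ω

/-- The sum of the minimizing player's gradients before round `t`. -/
def gradSum (A : OFTPLPlay μ X Y gx gy P₁ P₂ T m) (t : Fin T) (ω : Ω) : Vec d₁ :=
  ∑ i ∈ Finset.Iio t, gx (A.x i ω) (A.y i ω)

/-- The minimizing player's guess of the gradient in round `t`. -/
def gradGuess (A : OFTPLPlay μ X Y gx gy P₁ P₂ T m) (t : Fin T) (ω : Ω) : Vec d₁ :=
  gx (A.xPred t ω) (A.yPred t ω)

/-- The conditional mean of the minimizing player's prediction with zero guess. -/
def predMean (A : OFTPLPlay μ X Y gx gy P₁ P₂ T m) (t : Fin T) (ω : Ω) : Vec d₁ :=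
  gradPhi X P₁ (A.gradSum t ω)

/-- The conditional mean of the minimizing player's action. -/
def actMean (A : OFTPLPlay μ X Y gx gy P₁ P₂ T m) (t : Fin T) (ω : Ω) : Vec d₁ :=
  gradPhi X P₁ (A.gradSum t ω + A.gradGuess t ω)

variable (A : OFTPLPlay μ X Y gx gy P₁ P₂ T m)

lemma x_mem (hm : 0 < m) (hXc : Convex ℝ X) (t : Fin T) (ω : Ω) : A.x t ω ∈ X :=
  vecMean_mem hm hXc fun j => (A.xAct_spec t j ω).1

lemma y_mem (hm : 0 < m) (hYc : Convex ℝ Y) (t : Fin T) (ω : Ω) : A.y t ω ∈ Y :=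
  vecMean_mem hm hYc fun j => (A.yAct_spec t j ω).1

lemma xPred_mem (hm : 0 < m) (hXc : Convex ℝ X) (t : Fin T) (ω : Ω) : A.xPred t ω ∈ X :=
  vecMean_mem hm hXc fun j => (A.xGuess_spec t j ω).1

lemma yPred_mem (hm : 0 < m) (hYc : Convex ℝ Y) (t : Fin T) (ω : Ω) : A.yPred t ω ∈ Y :=
  vecMean_mem hm hYc fun j => (A.yGuess_spec t j ω).1

/-- The number of draws of perturbations completed before the given one. -/
def drawRank (p : (Stage × Fin T × Fin m) × Bool) : ℕ :=
  match p.1.1 with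
  | Stage.guess => 2 * (p.1.2.1 : ℕ)
  | Stage.act => 2 * (p.1.2.1 : ℕ) + 1

/-- Measurability, unbiasedness and variance of the predictions and actions of the minimizing
player. -/
theorem prediction_facts [IsProbabilityMeasure μ] [IsProbabilityMeasure P₁]
    [IsProbabilityMeasure P₂] (hm : 0 < m)
    (hX : IsCompact X) (hXc : Convex ℝ X) (hXn : X.Nonempty) (hP₁ : P₁ ≪ volume)
    (hY : IsCompact Y) (hYc : Convex ℝ Y) (hYn : Y.Nonempty) (hP₂ : P₂ ≪ volume)
    (hgx : Measurable fun z : ↥(X ×ˢ Y) => gx z.1.1 z.1.2)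
    (hgy : Measurable fun z : ↥(X ×ˢ Y) => gy z.1.1 z.1.2)
    {B K : ℝ} (hB : ∀ x ∈ X, ∀ y ∈ X, ‖x - y‖ ≤ B) (hK : ∀ x ∈ X, ∀ y ∈ Y, ‖gx x y‖ ≤ K)
    (t : Fin T) :
    AEStronglyMeasurable (A.x t) μ ∧ AEStronglyMeasurable (A.xPred t) μ ∧
    AEStronglyMeasurable (A.actMean t) μ ∧ AEStronglyMeasurable (A.predMean t) μ ∧
    ∫ ω, ‖A.x t ω - A.actMean t ω‖ ^ 2 ∂μ ≤ B ^ 2 / m ∧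
    ∫ ω, ‖A.xPred t ω - A.predMean t ω‖ ^ 2 ∂μ ≤ B ^ 2 / m ∧
    AEStronglyMeasurable (fun ω => gx (A.actMean t ω) (A.y t ω)) μ ∧
    ∫ ω, inner ℝ (gx (A.actMean t ω) (A.y t ω)) (A.x t ω - A.actMean t ω) ∂μ = 0 := by
  obtain ⟨U, V, hU, hV, hUV, hlawU, hlawV, hind⟩ := exists_independent_components
    (W := fun i : Stage × Fin T × Fin m => A.noise i.1 i.2.1 i.2.2)
    (fun i => A.noise_law i.1 i.2.1 i.2.2) A.noise_indep
  set mF : (Stage × Fin T × Fin m) × Bool → MeasurableSpace Ω :=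
    fun p => bif p.2 then MeasurableSpace.comap (U p.1) inferInstance
      else MeasurableSpace.comap (V p.1) inferInstance with hmF
  have hle : ∀ p, mF p ≤ ‹MeasurableSpace Ω› := by
    rintro ⟨i, _ | _⟩
    · exact (hV i).comap_le
    · exact (hU i).comap_le
  obtain ⟨B₂, hB₂⟩ : ∃ B₂, ∀ x ∈ Y, ∀ y ∈ Y, ‖x - y‖ ≤ B₂ := by
    obtain ⟨c, hc⟩ := hY.isBounded.exists_norm_le
    exact ⟨c + c, fun x hx y hy => (norm_sub_le _ _).trans (add_le_add (hc x hx) (hc y hy))⟩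
  -- The filtration of the game: the guesses of round `t` use draws of rank `2 * t`, its actions
  -- draws of rank `2 * t + 1`. Guesses are thus `F (2 * t + 1)`-measurable and actions `F (2 * t +
  -- 2)`-measurable.
  set F : ℕ → MeasurableSpace Ω := fun n => ⨆ p ∈ {p | drawRank p < n}, mF p with hF
  have hFmono : ∀ {n k : ℕ}, n ≤ k → F n ≤ F k := fun h =>
    biSup_mono fun p (hp : drawRank p < _) => lt_of_lt_of_le hp h
  have hFle : ∀ n, F n ≤ ‹MeasurableSpace Ω› := fun n => iSup₂_le fun i _ => hle i
  have hinj : ∀ (t : Fin T) (s : Stage) (b : Bool),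
      Function.Injective fun j : Fin m => ((s, t, j), b) := by
    intro t s b j k h
    simpa using h
  have hstep : ∀ t : Fin T,
      (∀ i < t, AEStronglyMeasurable[F (2 * t)] (A.x i) μ ∧
        AEStronglyMeasurable[F (2 * t)] (A.y i) μ) →
      AEStronglyMeasurable[F (2 * t)] (A.gradSum t) μ ∧
        AEStronglyMeasurable[F (2 * t)]
          (fun ω => -∑ i ∈ Finset.Iio t, gy (A.x i ω) (A.y i ω)) μ := by
    intro t h
    refine ⟨aestronglyMeasurable_sum_vec _ fun i hi => ?_,
      (aestronglyMeasurable_sum_vec _ fun i hi => ?_).neg⟩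
    · exact aestronglyMeasurable_of_measurable_restrict hX.isClosed hY.isClosed hgx
        (h i (Finset.mem_Iio.1 hi)).1 (h i (Finset.mem_Iio.1 hi)).2 (A.x_mem hm hXc i)
        (A.y_mem hm hYc i)
    · exact aestronglyMeasurable_of_measurable_restrict hX.isClosed hY.isClosed hgy
        (h i (Finset.mem_Iio.1 hi)).1 (h i (Finset.mem_Iio.1 hi)).2 (A.x_mem hm hXc i)
        (A.y_mem hm hYc i)
  have hIsub : ∀ {n k : ℕ}, n ≤ k →
      {p : (Stage × Fin T × Fin m) × Bool | drawRank p < n} ⊆ {p | drawRank p < k} :=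
    fun h p (hp : drawRank p < _) => lt_of_lt_of_le hp h
  have hmin : ∀ {q s y : Vec d₂}, IsLinearArgmax Y (q + s) y → IsLinearArgmin Y (-q - s) y := by
    intro q s y h
    refine ⟨h.1, fun z hz => ?_⟩
    have h2 := h.2 z hz
    simp only [inner_sub_left, inner_neg_left, inner_add_left] at h2 ⊢
    linarith
  have hround : ∀ t : Fin T,
      (∀ i < t, AEStronglyMeasurable[F (2 * t)] (A.x i) μ ∧
        AEStronglyMeasurable[F (2 * t)] (A.y i) μ) →
      (AEStronglyMeasurable[F (2 * t + 2)] (A.x t) μ ∧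
        AEStronglyMeasurable[F (2 * t + 2)] (A.y t) μ) ∧
      AEStronglyMeasurable (A.x t) μ ∧ AEStronglyMeasurable (A.xPred t) μ ∧
      AEStronglyMeasurable (A.actMean t) μ ∧ AEStronglyMeasurable (A.predMean t) μ ∧
      ∫ ω, ‖A.x t ω - A.actMean t ω‖ ^ 2 ∂μ ≤ B ^ 2 / m ∧
      ∫ ω, ‖A.xPred t ω - A.predMean t ω‖ ^ 2 ∂μ ≤ B ^ 2 / m ∧
      AEStronglyMeasurable (fun ω => gx (A.actMean t ω) (A.y t ω)) μ ∧
      ∫ ω, inner ℝ (gx (A.actMean t ω) (A.y t ω)) (A.x t ω - A.actMean t ω) ∂μ = 0 := by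
    intro t ht
    obtain ⟨hGx, hGy⟩ := hstep t ht
    obtain ⟨gx₁, gx₂, -⟩ := prediction_of_fresh_samples hm hX hXc hXn hP₁ hle hind
      (I := {p | drawRank p < 2 * t}) (p := fun j => ((Stage.guess, t, j), true))
      (hinj t Stage.guess true) (fun j => by simp [drawRank]) hGx
      (σ := fun j => U (Stage.guess, t, j)) (fun j => comap_measurable _) (fun j => hlawU _)
      (z := A.xGuess t) (fun j => by
        filter_upwards [hUV] with ω hω
        have h := A.xGuess_spec t j ω
        rw [hω (Stage.guess, t, j)] at h
        exact h) hB
    obtain ⟨gy₁, -, -⟩ := prediction_of_fresh_samples hm hY hYc hYn hP₂ hle hind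
      (I := {p | drawRank p < 2 * t}) (p := fun j => ((Stage.guess, t, j), false))
      (hinj t Stage.guess false) (fun j => by simp [drawRank]) hGy
      (σ := fun j => V (Stage.guess, t, j)) (fun j => comap_measurable _) (fun j => hlawV _)
      (z := A.yGuess t) (fun j => by
        filter_upwards [hUV] with ω hω
        have h := A.yGuess_spec t j ω
        rw [hω (Stage.guess, t, j)] at h
        exact hmin h) hB₂
    have hxP : AEStronglyMeasurable[F (2 * t + 1)] (A.xPred t) μ :=
      gx₁ _ (hIsub (Nat.le_succ _)) fun j => by simp [drawRank]
    have hyP : AEStronglyMeasurable[F (2 * t + 1)] (A.yPred t) μ :=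
      gy₁ _ (hIsub (Nat.le_succ _)) fun j => by simp [drawRank]
    have hgux : AEStronglyMeasurable[F (2 * t + 1)] (A.gradGuess t) μ :=
      aestronglyMeasurable_of_measurable_restrict hX.isClosed hY.isClosed hgx hxP hyP
        (A.xPred_mem hm hXc t) (A.yPred_mem hm hYc t)
    have hguy : AEStronglyMeasurable[F (2 * t + 1)]
        (fun ω => gy (A.xPred t ω) (A.yPred t ω)) μ :=
      aestronglyMeasurable_of_measurable_restrict hX.isClosed hY.isClosed hgy hxP hyP
        (A.xPred_mem hm hXc t) (A.yPred_mem hm hYc t)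
    have hqx : AEStronglyMeasurable[F (2 * t + 1)]
        (fun ω => A.gradSum t ω + A.gradGuess t ω) μ :=
      (hGx.mono (hFmono (Nat.le_succ _))).add hgux
    have hqy : AEStronglyMeasurable[F (2 * t + 1)]
        (fun ω => -∑ i ∈ Finset.Iio t, gy (A.x i ω) (A.y i ω)
          - gy (A.xPred t ω) (A.yPred t ω)) μ :=
      (hGy.mono (hFmono (Nat.le_succ _))).sub hguy
    obtain ⟨ax₁, ax₂, ax₃⟩ := prediction_of_fresh_samples hm hX hXc hXn hP₁ hle hind
      (I := {p | drawRank p < 2 * t + 1}) (p := fun j => ((Stage.act, t, j), true))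
      (hinj t Stage.act true) (fun j => by simp [drawRank]) hqx
      (σ := fun j => U (Stage.act, t, j)) (fun j => comap_measurable _) (fun j => hlawU _)
      (z := A.xAct t) (fun j => by
        filter_upwards [hUV] with ω hω
        have h := A.xAct_spec t j ω
        rw [hω (Stage.act, t, j)] at h
        exact h) hB
    obtain ⟨ay₁, -, -⟩ := prediction_of_fresh_samples hm hY hYc hYn hP₂ hle hind
      (I := {p | drawRank p < 2 * t + 1}) (p := fun j => ((Stage.act, t, j), false))
      (hinj t Stage.act false) (fun j => by simp [drawRank]) hqy
      (σ := fun j => V (Stage.act, t, j)) (fun j => comap_measurable _) (fun j => hlawV _)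
      (z := A.yAct t) (fun j => by
        filter_upwards [hUV] with ω hω
        have h := hmin (A.yAct_spec t j ω)
        rw [hω (Stage.act, t, j), neg_add'] at h
        exact h) hB₂
    have hx : AEStronglyMeasurable[F (2 * t + 2)] (A.x t) μ :=
      ax₁ _ (hIsub (Nat.le_succ _)) fun j => by simp [drawRank]
    have hy : AEStronglyMeasurable[F (2 * t + 2)] (A.y t) μ :=
      ay₁ _ (hIsub (Nat.le_succ _)) fun j => by simp [drawRank]
    have hgm := measurable_gradPhi hX hXn hP₁
    have hact : AEStronglyMeasurable[F (2 * t + 1)] (A.actMean t) μ := hqx.measurable_comp hgm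
    have hpred : AEStronglyMeasurable[F (2 * t)] (A.predMean t) μ := hGx.measurable_comp hgm
    have hactX : ∀ ω, A.actMean t ω ∈ X := fun ω => gradPhi_mem hX hXc hXn hP₁ _
    -- Everything before the actions of round `t`, and all draws of the `y` player. This makes `y_t`
    -- measurable while excluding the fresh draws behind `x_t`.
    set J : Set ((Stage × Fin T × Fin m) × Bool) :=
      {p | drawRank p < 2 * t + 1} ∪ {p | p.2 = false} with hJ
    have hIJ : {p | drawRank p < 2 * t + 1} ⊆ J := Set.subset_union_left
    have hgact := aestronglyMeasurable_of_measurable_restrict hX.isClosed hY.isClosed hgx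
      (hact.mono (biSup_mono hIJ)) (ay₁ J hIJ fun j => Or.inr rfl) hactX (A.y_mem hm hYc t)
    exact ⟨⟨hx, hy⟩, hx.mono (hFle _), hxP.mono (hFle _), hact.mono (hFle _),
      hpred.mono (hFle _), ax₂, gx₂, hgact.mono (iSup₂_le fun i _ => hle i),
      ax₃ J hIJ (fun j => by simp [hJ, drawRank]) _ K hgact fun ω =>
        hK _ (hactX ω) _ (A.y_mem hm hYc t ω)⟩
  -- Both players' actions are handled in one strong induction, since each objective involves the
  -- past actions of both.
  have hall : ∀ n : ℕ, ∀ t : Fin T, (t : ℕ) = n → AEStronglyMeasurable[F (2 * t + 2)] (A.x t) μ ∧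
      AEStronglyMeasurable[F (2 * t + 2)] (A.y t) μ := by
    intro n
    induction n using Nat.strong_induction_on with
    | _ n ih =>
      intro t ht
      refine (hround t fun i hi => ?_).1
      have hit : (i : ℕ) < t := hi
      obtain ⟨h1, h2⟩ := ih i (by omega) i rfl
      exact ⟨h1.mono (hFmono (by omega)), h2.mono (hFmono (by omega))⟩
  refine (hround t fun i hi => ?_).2
  have hit : (i : ℕ) < t := hi
  exact ⟨(hall i i rfl).1.mono (hFmono (by omega)), (hall i i rfl).2.mono (hFmono (by omega))⟩

end OFTPLPlay

/-! ### Elementary inequalities behind the constants -/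

section Numerics

lemma holderPow_le_rpow {α t : ℝ} (ht : 0 ≤ t) : holderPow α t ≤ t ^ α := by
  unfold holderPow
  split_ifs
  · exact Real.rpow_nonneg ht α
  · exact le_rfl

/-- Powers with exponent in `[0, 1]` are monotone and subadditive. -/
lemma rpow_le_of_le_add₃ {α a b c w : ℝ} (hα₀ : 0 ≤ α) (hα₁ : α ≤ 1) (ha : 0 ≤ a) (hb : 0 ≤ b)
    (hc : 0 ≤ c) (hw : 0 ≤ w) (h : w ≤ a + b + c) : w ^ α ≤ a ^ α + b ^ α + c ^ α := by
  refine (Real.rpow_le_rpow hw h hα₀).trans ?_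
  refine (Real.rpow_add_le_add_rpow (add_nonneg ha hb) hc hα₀ hα₁).trans ?_
  exact add_le_add_left (Real.rpow_add_le_add_rpow ha hb hα₀ hα₁) _

lemma rpow_two_mul {a : ℝ} (ha : 0 ≤ a) (α : ℝ) : a ^ (2 * α) = (a ^ α) ^ 2 := by
  rw [mul_comm, Real.rpow_mul ha, Real.rpow_two]

/-- With `S` the sum of the four deviations and `W` that of the two shifts, `(S + W)² ≤ 5/4 S² + 5
W²`, then `S²` and `W²` are bounded by Cauchy–Schwarz. The weights favour the deviations, whose
coefficient enters the final bound directly. -/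
lemma sq_sum_six_le (a b c a' b' c' : ℝ) : (a + c + b + (a' + c' + b')) ^ 2
    ≤ 5 * (a ^ 2 + b ^ 2 + a' ^ 2 + b' ^ 2) + 10 * (c ^ 2 + c' ^ 2) := by
  have h₁ : (a + b + a' + b') ^ 2 ≤ 4 * (a ^ 2 + b ^ 2 + a' ^ 2 + b' ^ 2) := by
    linarith [sq_nonneg (a - b), sq_nonneg (a - a'), sq_nonneg (a - b'), sq_nonneg (b - a'),
      sq_nonneg (b - b'), sq_nonneg (a' - b')]
  have h₂ : (c + c') ^ 2 ≤ 2 * (c ^ 2 + c' ^ 2) := by linarith [sq_nonneg (c - c')]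
  linarith [sq_nonneg ((a + b + a' + b') - 4 * (c + c'))]

/-- The error caused by the movement of the mean prediction, minus the stability gain. -/
lemma shift_residual_le {α β L p : ℝ} (hα₀ : 0 ≤ α) (hα₁ : α < 1) (hβ : 0 ≤ β) (hL : 0 ≤ L)
    (hp : 0 ≤ p) :
    10 * β * L ^ 2 * p ^ (2 * α) - 1 / (2 * β) * p ^ 2
      ≤ 5 * L * (5 * β * L) ^ ((1 + α) / (1 - α)) := by
  have hRHS : 0 ≤ 5 * L * (5 * β * L) ^ ((1 + α) / (1 - α)) := by positivity
  rcases hβ.eq_or_lt with hb | hb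
  · subst hb
    simpa using hRHS
  rcases hL.eq_or_lt with hl | hl
  · have h : 0 ≤ 1 / (2 * β) * p ^ 2 := by positivity
    rw [← hl] at hRHS ⊢
    simp only [ne_eq, OfNat.ofNat_ne_zero, not_false_eq_true, zero_pow, mul_zero, zero_mul] at *
    linarith
  have hα : 0 < 1 - α := by linarith
  set c := 5 * β * L with hc
  have hc0 : 0 < c := by positivity
  -- At the scale `p = k * r` the two terms balance: they become `2 * L * M * r ^ (2 * α)` and `5 /
  -- 2 * L * M * r ^ 2`. Since `r ^ (2 * α) ≤ 1 + r ^ 2`, the difference is at most `2 * L * M`.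
  set k := c ^ (1 / (1 - α)) with hk
  have hk0 : 0 < k := Real.rpow_pos_of_pos hc0 _
  have hck : c = k ^ (1 - α) := by
    rw [hk, ← Real.rpow_mul hc0.le, one_div_mul_cancel hα.ne', Real.rpow_one]
  set M := k ^ (1 + α) with hM
  have hM0 : 0 < M := Real.rpow_pos_of_pos hk0 _
  have hcM : c ^ ((1 + α) / (1 - α)) = M := by
    rw [hM, hk, ← Real.rpow_mul hc0.le]
    congr 1
    ring
  have h1 : c * k ^ (2 * α) = M := by
    rw [hck, hM, ← Real.rpow_add hk0]
    congr 1
    ring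
  have h2 : k ^ 2 = c * M := by
    rw [hck, hM, ← Real.rpow_add hk0, ← Real.rpow_two]
    congr 1
    ring
  obtain ⟨r, hr0, rfl⟩ : ∃ r, 0 ≤ r ∧ p = k * r :=
    ⟨p / k, by positivity, by field_simp⟩
  have h3 : r ^ (2 * α) ≤ 1 + r ^ 2 := by
    rcases le_total r 1 with h | h
    · have := Real.rpow_le_one hr0 h (by positivity : 0 ≤ 2 * α)
      nlinarith [sq_nonneg r]
    · have := Real.rpow_le_rpow_of_exponent_le h (by linarith : 2 * α ≤ 2)
      rw [Real.rpow_two] at this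
      linarith
  rw [hcM, Real.mul_rpow hk0.le hr0, mul_pow, h2]
  have e1 : 10 * β * L ^ 2 * (k ^ (2 * α) * r ^ (2 * α)) = 2 * L * M * r ^ (2 * α) := by
    rw [← h1, hc]; ring
  have e2 : 1 / (2 * β) * (c * M * r ^ 2) = 5 / 2 * L * M * r ^ 2 := by
    rw [hc]; field_simp
  rw [e1, e2]
  have hLM : 0 < L * M := by positivity
  nlinarith [mul_le_mul_of_nonneg_left h3 hLM.le, mul_nonneg hLM.le (sq_nonneg r)]

/-- Both terms are multiples of `p²`, and for `β > 0` the sign condition `20 (β L)² ≤ 1` follows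
from `5 β L ≤ 1`. -/
lemma shift_residual_le_of_eq_one {β L p : ℝ} (hβ : 0 ≤ β) (hL : 0 ≤ L) (h : 5 * β * L ≤ 1) :
    10 * β * L ^ 2 * p ^ (2 * (1 : ℝ)) - 1 / (2 * β) * p ^ 2 ≤ 0 := by
  rw [mul_one, Real.rpow_two, ← sub_mul]
  refine mul_nonpos_of_nonpos_of_nonneg ?_ (sq_nonneg p)
  rcases hβ.eq_or_lt with hb | hb
  · simp [← hb]
  rw [sub_nonpos, le_div_iff₀ (by positivity)]
  have h0 : 0 ≤ 5 * β * L := by positivity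
  nlinarith

end Numerics

lemma dualNorm_neg {d : ℕ} {N : Seminorm ℝ (Vec d)} (hN : ∀ x, N x = 0 → x = 0) (x : Vec d) :
    dualNorm N (-x) = dualNorm N x := by
  rw [← coe_dualSeminorm hN, map_neg_eq_map]

/-! ### Pathwise regret of one player -/

namespace OFTPLPlay

variable {d₁ d₂ : ℕ} {Ω : Type*} [MeasurableSpace Ω] {μ : Measure Ω}
  {X : Set (Vec d₁)} {Y : Set (Vec d₂)}
  {gx : Vec d₁ → Vec d₂ → Vec d₁} {gy : Vec d₁ → Vec d₂ → Vec d₂}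
  {P₁ : Measure (Vec d₁)} {P₂ : Measure (Vec d₂)} {T m : ℕ}

/-- The deviation of the action from its conditional mean. -/
def actDev (N : Seminorm ℝ (Vec d₁)) (A : OFTPLPlay μ X Y gx gy P₁ P₂ T m) (t : Fin T) (ω : Ω) : ℝ :=
  N (A.x t ω - A.actMean t ω)

/-- The deviation of the prediction with zero guess from its conditional mean. -/
def predDev (N : Seminorm ℝ (Vec d₁)) (A : OFTPLPlay μ X Y gx gy P₁ P₂ T m) (t : Fin T) (ω : Ω) : ℝ :=
  N (A.xPred t ω - A.predMean t ω)

/-- The distance between the conditional means of the action and of the prediction with zero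
guess. -/
def meanShift (N : Seminorm ℝ (Vec d₁)) (A : OFTPLPlay μ X Y gx gy P₁ P₂ T m) (t : Fin T) (ω : Ω) :
    ℝ :=
  N (A.actMean t ω - A.predMean t ω)

/-- The pairing of the action's deviation with the gradient at the conditional mean. -/
def noiseTerm (A : OFTPLPlay μ X Y gx gy P₁ P₂ T m) (t : Fin T) (ω : Ω) : ℝ :=
  inner ℝ (gx (A.actMean t ω) (A.y t ω)) (A.x t ω - A.actMean t ω)

variable (A : OFTPLPlay μ X Y gx gy P₁ P₂ T m)

lemma dist_xPred_le (N : Seminorm ℝ (Vec d₁)) (t : Fin T) (ω : Ω) :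
    N (A.x t ω - A.xPred t ω) ≤ A.actDev N t ω + A.meanShift N t ω + A.predDev N t ω := by
  have h : A.x t ω - A.xPred t ω = (A.x t ω - A.actMean t ω)
      + (A.actMean t ω - A.predMean t ω) - (A.xPred t ω - A.predMean t ω) := by abel
  rw [h]
  exact (map_sub_le_add N _ _).trans (add_le_add_left (map_add_le_add N _ _) _)

/-- The linearized regret of the minimizing player along a run. -/
theorem sum_inner_le [IsProbabilityMeasure P₁] [IsProbabilityMeasure P₂]
    {N₁ : Seminorm ℝ (Vec d₁)} (hN₁ : ∀ x, N₁ x = 0 → x = 0)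
    {N₂ : Seminorm ℝ (Vec d₂)} (hm : 0 < m)
    (hX : IsCompact X) (hXc : Convex ℝ X) (hXn : X.Nonempty) (hP₁ : P₁ ≪ volume)
    (hYc : Convex ℝ Y) {α L₁ L₂ L D β η : ℝ} (hα₀ : 0 ≤ α) (hα₁ : α ≤ 1) (hβ : 0 ≤ β)
    (hL₁ : 0 ≤ L₁) (hL₁L : L₁ ≤ L) (hL₂L : L₂ ≤ L)
    (hsmooth : ∀ x ∈ X, ∀ y ∈ Y, ∀ x' ∈ X, ∀ y' ∈ Y,
      dualNorm N₁ (gx x y - gx x' y')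
        ≤ L₁ * holderPow α (N₁ (x - x')) + L₂ * holderPow α (N₂ (y - y')))
    (hD : normDiam N₁ X ≤ D) (hint : Integrable (dualNorm N₁) P₁)
    (hη : ∫ σ, dualNorm N₁ σ ∂P₁ = η) (hstable : PredictionsStable (dualNorm N₁) X P₁ β)
    {x : Vec d₁} (hx : x ∈ X) (ω : Ω) :
    ∑ t, inner ℝ (gx (A.x t ω) (A.y t ω)) (A.x t ω - x) ≤ η * D + ∑ t, (A.noiseTerm t ω
      + L₁ * A.actDev N₁ t ω ^ (1 + α)
      + 5 / 2 * β * L ^ 2 * (A.actDev N₁ t ω ^ (2 * α) + A.predDev N₁ t ω ^ (2 * α)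
        + A.swap.actDev N₂ t ω ^ (2 * α) + A.swap.predDev N₂ t ω ^ (2 * α))
      + 5 * β * L ^ 2 * (A.meanShift N₁ t ω ^ (2 * α) + A.swap.meanShift N₂ t ω ^ (2 * α))
      - 1 / (2 * β) * A.meanShift N₁ t ω ^ 2) := by
  have hL : 0 ≤ L := hL₁.trans hL₁L
  have hη0 : 0 ≤ η := hη ▸ integral_nonneg fun σ => dualNorm_nonneg hN₁ σ
  obtain ⟨Φ, hsup, hΦ⟩ := exists_potential hX hXn hP₁ hN₁ hint
  have hlip : ∀ a b, N₁ (gradPhi X P₁ a - gradPhi X P₁ b) ≤ β * dualNorm N₁ (a - b) :=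
    fun a b => (le_dualNorm_dualNorm hN₁ _).trans (hstable a b)
  have hreg := optimistic_regret hN₁ hβ hsup hlip (x := x) (B := η * D) (fun a => by
      refine (hΦ a x hx).trans (add_le_add_right ?_ _)
      rw [hη, mul_comm]
      exact mul_le_mul_of_nonneg_left hD hη0)
    (fun t => gx (A.x t ω) (A.y t ω)) (fun t => A.gradGuess t ω)
  have hterm : ∀ t, inner ℝ (gx (A.x t ω) (A.y t ω)) (A.x t ω - x)
      - inner ℝ (gx (A.x t ω) (A.y t ω)) (A.actMean t ω - x)
      + (β / 2 * dualNorm N₁ (gx (A.x t ω) (A.y t ω) - A.gradGuess t ω) ^ 2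
        - 1 / (2 * β) * A.meanShift N₁ t ω ^ 2) ≤ A.noiseTerm t ω
      + L₁ * A.actDev N₁ t ω ^ (1 + α)
      + 5 / 2 * β * L ^ 2 * (A.actDev N₁ t ω ^ (2 * α) + A.predDev N₁ t ω ^ (2 * α)
        + A.swap.actDev N₂ t ω ^ (2 * α) + A.swap.predDev N₂ t ω ^ (2 * α))
      + 5 * β * L ^ 2 * (A.meanShift N₁ t ω ^ (2 * α) + A.swap.meanShift N₂ t ω ^ (2 * α))
      - 1 / (2 * β) * A.meanShift N₁ t ω ^ 2 := by
    intro t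
    have hxX := A.x_mem hm hXc t ω
    have hyY := A.y_mem hm hYc t ω
    have hcX : A.actMean t ω ∈ X := gradPhi_mem hX hXc hXn hP₁ _
    have a0 : 0 ≤ A.actDev N₁ t ω := apply_nonneg N₁ _
    have b0 : 0 ≤ A.predDev N₁ t ω := apply_nonneg N₁ _
    have c0 : 0 ≤ A.meanShift N₁ t ω := apply_nonneg N₁ _
    have a0' : 0 ≤ A.swap.actDev N₂ t ω := apply_nonneg N₂ _
    have b0' : 0 ≤ A.swap.predDev N₂ t ω := apply_nonneg N₂ _
    have c0' : 0 ≤ A.swap.meanShift N₂ t ω := apply_nonneg N₂ _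
    have hnoise : inner ℝ (gx (A.x t ω) (A.y t ω)) (A.x t ω - x)
        - inner ℝ (gx (A.x t ω) (A.y t ω)) (A.actMean t ω - x)
        ≤ A.noiseTerm t ω + L₁ * A.actDev N₁ t ω ^ (1 + α) := by
      have h1 := inner_le_mul_dualNorm hN₁ (A.x t ω - A.actMean t ω)
        (gx (A.x t ω) (A.y t ω) - gx (A.actMean t ω) (A.y t ω))
      have h2 := hsmooth _ hxX _ hyY _ hcX _ hyY
      -- Here the convention at zero matters: for `α = 0`, `Real.rpow` would give `0 ^ 0 = 1` and
      -- leave a spurious `L₂`.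
      have h3 : holderPow α (N₂ (A.y t ω - A.y t ω)) = 0 := by simp [holderPow]
      rw [h3, mul_zero, add_zero] at h2
      have h4 : dualNorm N₁ (gx (A.x t ω) (A.y t ω) - gx (A.actMean t ω) (A.y t ω))
          ≤ L₁ * A.actDev N₁ t ω ^ α :=
        h2.trans (mul_le_mul_of_nonneg_left (holderPow_le_rpow a0) hL₁)
      have h5 : A.actDev N₁ t ω * (L₁ * A.actDev N₁ t ω ^ α)
          = L₁ * A.actDev N₁ t ω ^ (1 + α) := by
        rw [Real.rpow_one_add' a0 (by linarith)]; ring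
      have h6 : _ ≤ A.actDev N₁ t ω * (L₁ * A.actDev N₁ t ω ^ α) := h1.trans (mul_le_mul_of_nonneg_left h4 a0)
      rw [h5, real_inner_comm, inner_sub_left] at h6
      have h7 : (inner ℝ (gx (A.x t ω) (A.y t ω)) (A.x t ω - x) : ℝ)
          - inner ℝ (gx (A.x t ω) (A.y t ω)) (A.actMean t ω - x)
          = inner ℝ (gx (A.x t ω) (A.y t ω)) (A.x t ω - A.actMean t ω) := by
        rw [← inner_sub_right, sub_sub_sub_cancel_right]
      rw [h7]
      unfold noiseTerm
      linarith
    have hguess : dualNorm N₁ (gx (A.x t ω) (A.y t ω) - A.gradGuess t ω) ≤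
        L * ((A.actDev N₁ t ω ^ α + A.meanShift N₁ t ω ^ α + A.predDev N₁ t ω ^ α)
          + (A.swap.actDev N₂ t ω ^ α + A.swap.meanShift N₂ t ω ^ α
            + A.swap.predDev N₂ t ω ^ α)) := by
      refine (hsmooth _ hxX _ hyY _ (A.xPred_mem hm hXc t ω) _ (A.yPred_mem hm hYc t ω)).trans ?_
      rw [mul_add]
      have k1 : holderPow α (N₁ (A.x t ω - A.xPred t ω)) ≤
          A.actDev N₁ t ω ^ α + A.meanShift N₁ t ω ^ α + A.predDev N₁ t ω ^ α :=
        (holderPow_le_rpow (apply_nonneg N₁ _)).trans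
          (rpow_le_of_le_add₃ hα₀ hα₁ a0 c0 b0 (apply_nonneg N₁ _) (A.dist_xPred_le N₁ t ω))
      have k2 : holderPow α (N₂ (A.y t ω - A.yPred t ω)) ≤
          A.swap.actDev N₂ t ω ^ α + A.swap.meanShift N₂ t ω ^ α + A.swap.predDev N₂ t ω ^ α :=
        (holderPow_le_rpow (apply_nonneg N₂ _)).trans
          (rpow_le_of_le_add₃ hα₀ hα₁ a0' c0' b0' (apply_nonneg N₂ _)
            (A.swap.dist_xPred_le N₂ t ω))
      have k3 : ∀ v : ℝ, 0 ≤ v → 0 ≤ holderPow α v := by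
        intro v hv
        unfold holderPow
        split_ifs
        · exact le_rfl
        · exact Real.rpow_nonneg hv α
      exact add_le_add
        (mul_le_mul hL₁L k1 (k3 _ (apply_nonneg N₁ _)) hL)
        (mul_le_mul hL₂L k2 (k3 _ (apply_nonneg N₂ _)) hL)
    have hsq := pow_le_pow_left₀ (dualNorm_nonneg hN₁ _) hguess 2
    rw [mul_pow] at hsq
    simp only [rpow_two_mul a0, rpow_two_mul b0, rpow_two_mul c0, rpow_two_mul a0',
      rpow_two_mul b0', rpow_two_mul c0']
    set a := A.actDev N₁ t ω ^ α
    set b := A.predDev N₁ t ω ^ α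
    set c := A.meanShift N₁ t ω ^ α
    set a' := A.swap.actDev N₂ t ω ^ α
    set b' := A.swap.predDev N₂ t ω ^ α
    set c' := A.swap.meanShift N₂ t ω ^ α
    have hyoung := sq_sum_six_le a b c a' b' c'
    have hcomb : β / 2 * dualNorm N₁ (gx (A.x t ω) (A.y t ω) - A.gradGuess t ω) ^ 2
        ≤ β / 2 * (L ^ 2 * (5 * (a ^ 2 + b ^ 2 + a' ^ 2 + b' ^ 2) + 10 * (c ^ 2 + c' ^ 2))) :=
      mul_le_mul_of_nonneg_left
        (hsq.trans (mul_le_mul_of_nonneg_left hyoung (sq_nonneg L))) (by positivity)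
    linarith
  have hsum := Finset.sum_le_sum fun t (_ : t ∈ Finset.univ) => hterm t
  have hreg' : ∑ t, (inner ℝ (gx (A.x t ω) (A.y t ω)) (A.actMean t ω - x) : ℝ) ≤ η * D
      + ∑ t, (β / 2 * dualNorm N₁ (gx (A.x t ω) (A.y t ω) - A.gradGuess t ω) ^ 2
        - 1 / (2 * β) * A.meanShift N₁ t ω ^ 2) := hreg
  rw [Finset.sum_add_distrib, Finset.sum_sub_distrib] at hsum
  linarith

end OFTPLPlay

/-! ### Convexity, integrability and boundedness -/

section Convex

variable {d : ℕ} {X : Set (Vec d)}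

/-- The gradient inequality for a convex function on a convex set. -/
lemma ConvexOn.add_inner_gradient_le {F : Vec d → ℝ} {g a b : Vec d} (hF : ConvexOn ℝ X F)
    (hg : HasGradientWithinAt F g X a) (ha : a ∈ X) (hb : b ∈ X) :
    F a + inner ℝ g (b - a) ≤ F b := by
  -- Restriction to the segment from `a` to `b` reduces the claim to slopes in one variable, so `X`
  -- may have empty interior.
  have hmaps : Set.MapsTo (AffineMap.lineMap a b : ℝ → Vec d) (Set.Icc 0 1) X :=
    fun t ht => hF.1.lineMap_mem ha hb ht
  have hconv : ConvexOn ℝ (Set.Icc (0 : ℝ) 1) (F ∘ AffineMap.lineMap a b) :=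
    (hF.comp_affineMap (AffineMap.lineMap a b)).subset hmaps (convex_Icc 0 1)
  have hd : HasDerivWithinAt (F ∘ AffineMap.lineMap a b)
      ((InnerProductSpace.toDual ℝ (Vec d) g) (b - a)) (Set.Icc (0 : ℝ) 1) 0 := by
    refine HasFDerivWithinAt.comp_hasDerivWithinAt_of_eq (0 : ℝ) hg.hasFDerivWithinAt
      (AffineMap.hasDerivWithinAt_lineMap) hmaps (by simp)
  have h := hconv.le_slope_of_hasDerivWithinAt (x := 0) (y := 1) (by simp) (by simp) one_pos hd
  rw [slope_def_field] at h
  simp only [InnerProductSpace.toDual_apply_apply, Function.comp_apply, AffineMap.lineMap_apply_one,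
    AffineMap.lineMap_apply_zero, sub_zero, div_one] at h
  linarith

lemma ConvexOn.map_vecMean_le {F : Vec d → ℝ} (hF : ConvexOn ℝ X F) {T : ℕ} (hT : 0 < T)
    {v : Fin T → Vec d} (hv : ∀ t, v t ∈ X) : F (vecMean v) ≤ (T : ℝ)⁻¹ * ∑ t, F (v t) := by
  have hT' : (T : ℝ) ≠ 0 := by positivity
  rw [vecMean, Finset.smul_sum, Finset.mul_sum]
  exact hF.map_sum_le (fun _ _ => by positivity) (by simp [hT']) fun t _ => hv t

lemma integrable_comp_of_continuousOn {Ω : Type*} {mΩ : MeasurableSpace Ω} {μ : Measure Ω}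
    [IsFiniteMeasure μ] (hX : IsCompact X) {F : Vec d → ℝ} (hF : ContinuousOn F X) {x : Ω → Vec d}
    (hx : AEStronglyMeasurable x μ) (hxX : ∀ ω, x ω ∈ X) : Integrable (fun ω => F (x ω)) μ := by
  obtain ⟨G, hG, hGF⟩ := (MeasurableEmbedding.subtype_coe hX.measurableSet).exists_measurable_extend
    (continuousOn_iff_continuous_domRestrict.1 hF).measurable fun _ => ⟨0⟩
  obtain ⟨K, hK⟩ := (hX.image_of_continuousOn hF).isBounded.exists_norm_le
  refine Integrable.of_bound ((hx.measurable_comp hG).congr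
    (Filter.Eventually.of_forall fun ω => ?_)) K
    (Filter.Eventually.of_forall fun ω => hK _ ⟨_, hxX ω, rfl⟩)
  exact congrFun hGF ⟨x ω, hxX ω⟩

end Convex

/-- Hölder control on a bounded set gives boundedness, even for `α = 0`, where the gradient need not
be continuous. It serves the integrability of the noise term and the centering. -/
lemma exists_gradient_bound {d₁ d₂ : ℕ} {X : Set (Vec d₁)} {Y : Set (Vec d₂)}
    {gx : Vec d₁ → Vec d₂ → Vec d₁}
    {N₁ : Seminorm ℝ (Vec d₁)} (hN₁ : ∀ x, N₁ x = 0 → x = 0) {N₂ : Seminorm ℝ (Vec d₂)}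
    (hX : IsCompact X) (hXn : X.Nonempty) (hY : IsCompact Y) (hYn : Y.Nonempty)
    {α L₁ L₂ : ℝ} (hα₀ : 0 ≤ α) (hL₁ : 0 ≤ L₁) (hL₂ : 0 ≤ L₂)
    (hsmooth : ∀ x ∈ X, ∀ y ∈ Y, ∀ x' ∈ X, ∀ y' ∈ Y,
      dualNorm N₁ (gx x y - gx x' y')
        ≤ L₁ * holderPow α (N₁ (x - x')) + L₂ * holderPow α (N₂ (y - y'))) :
    ∃ K, ∀ x ∈ X, ∀ y ∈ Y, ‖gx x y‖ ≤ K := by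
  obtain ⟨x₀, hx₀⟩ := hXn
  obtain ⟨y₀, hy₀⟩ := hYn
  obtain ⟨c, hc, -, hcN⟩ := exists_seminorm_bounds (dualSeminorm_definite hN₁)
  refine ⟨c * (L₁ * normDiam N₁ X ^ α + L₂ * normDiam N₂ Y ^ α) + ‖gx x₀ y₀‖,
    fun x hx y hy => ?_⟩
  have h1 := hsmooth x hx y hy x₀ hx₀ y₀ hy₀
  have h2 : holderPow α (N₁ (x - x₀)) ≤ normDiam N₁ X ^ α :=
    (holderPow_le_rpow (apply_nonneg N₁ _)).trans
      (Real.rpow_le_rpow (apply_nonneg N₁ _) (sub_le_normDiam hX hx hx₀) hα₀)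
  have h3 : holderPow α (N₂ (y - y₀)) ≤ normDiam N₂ Y ^ α :=
    (holderPow_le_rpow (apply_nonneg N₂ _)).trans
      (Real.rpow_le_rpow (apply_nonneg N₂ _) (sub_le_normDiam hY hy hy₀) hα₀)
  have h4 : ‖gx x y - gx x₀ y₀‖ ≤ c * (L₁ * normDiam N₁ X ^ α + L₂ * normDiam N₂ Y ^ α) :=
    (hcN _).trans (mul_le_mul_of_nonneg_left (h1.trans (add_le_add
      (mul_le_mul_of_nonneg_left h2 hL₁) (mul_le_mul_of_nonneg_left h3 hL₂))) hc.le)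
  have h5 := norm_add_le (gx x y - gx x₀ y₀) (gx x₀ y₀)
  rw [sub_add_cancel] at h5
  linarith

/-- Moments of a random vector in a norm, from its Euclidean variance. -/
lemma integral_seminorm_rpow_le {d : ℕ} {Ω : Type*} {mΩ : MeasurableSpace Ω} {μ : Measure Ω}
    [IsProbabilityMeasure μ] {N : Seminorm ℝ (Vec d)} {u : Ω → Vec d}
    (hu : AEStronglyMeasurable u μ) {B Ψ s v : ℝ} (hB : ∀ ω, ‖u ω‖ ≤ B) (hΨ0 : 0 ≤ Ψ)
    (hΨ : ∀ z, N z ≤ Ψ * ‖z‖) (hvar : ∫ ω, ‖u ω‖ ^ 2 ∂μ ≤ v) (hs : 0 ≤ s)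
    (hv : Ψ ^ 2 * v = s ^ 2) {p : ℝ} (hp0 : 0 ≤ p) (hp2 : p ≤ 2) :
    Integrable (fun ω => N (u ω) ^ p) μ ∧ ∫ ω, N (u ω) ^ p ∂μ ≤ s ^ p := by
  have hNu : AEStronglyMeasurable (fun ω => N (u ω)) μ :=
    (continuous_seminorm_vec N).comp_aestronglyMeasurable hu
  have hNB : ∀ ω, N (u ω) ≤ Ψ * B := fun ω =>
    (hΨ _).trans (mul_le_mul_of_nonneg_left (hB ω) hΨ0)
  refine integral_rpow_le_of_integral_sq_le (fun ω => apply_nonneg N _) hNu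
    (Filter.Eventually.of_forall hNB) hs ?_ hp0 hp2
  have hi1 : Integrable (fun ω => N (u ω) ^ 2) μ :=
    Integrable.of_bound (hNu.pow 2) ((Ψ * B) ^ 2) (Filter.Eventually.of_forall fun ω => by
      rw [Real.norm_of_nonneg (sq_nonneg _)]
      exact pow_le_pow_left₀ (apply_nonneg N _) (hNB ω) 2)
  have hi2 : Integrable (fun ω => ‖u ω‖ ^ 2) μ :=
    Integrable.of_bound (hu.norm.pow 2) (B ^ 2) (Filter.Eventually.of_forall fun ω => by
      rw [Real.norm_of_nonneg (sq_nonneg _)]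
      exact pow_le_pow_left₀ (norm_nonneg _) (hB ω) 2)
  calc ∫ ω, N (u ω) ^ 2 ∂μ ≤ ∫ ω, Ψ ^ 2 * ‖u ω‖ ^ 2 ∂μ :=
        integral_mono hi1 (hi2.const_mul _) fun ω => by
          have := pow_le_pow_left₀ (apply_nonneg N (u ω)) (hΨ (u ω)) 2
          rwa [mul_pow] at this
    _ = Ψ ^ 2 * ∫ ω, ‖u ω‖ ^ 2 ∂μ := integral_const_mul _ _
    _ ≤ Ψ ^ 2 * v := mul_le_mul_of_nonneg_left hvar (sq_nonneg Ψ)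
    _ = s ^ 2 := hv

/-! ### Moments of the sampling errors -/

namespace OFTPLPlay

variable {d₁ d₂ : ℕ} {Ω : Type*} [MeasurableSpace Ω] {μ : Measure Ω}
  {X : Set (Vec d₁)} {Y : Set (Vec d₂)}
  {gx : Vec d₁ → Vec d₂ → Vec d₁} {gy : Vec d₁ → Vec d₂ → Vec d₂}
  {P₁ : Measure (Vec d₁)} {P₂ : Measure (Vec d₂)} {T m : ℕ}
  (A : OFTPLPlay μ X Y gx gy P₁ P₂ T m)

/-- The random errors of the minimizing player: the linear term has mean zero, and the deviations
from the conditional means are of order `m ^ (-1/2)`. -/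
theorem deviation_facts [IsProbabilityMeasure μ] [IsProbabilityMeasure P₁]
    [IsProbabilityMeasure P₂] (hm : 0 < m)
    (hX : IsCompact X) (hXc : Convex ℝ X) (hXn : X.Nonempty) (hP₁ : P₁ ≪ volume)
    (hY : IsCompact Y) (hYc : Convex ℝ Y) (hYn : Y.Nonempty) (hP₂ : P₂ ≪ volume)
    (hgx : Measurable fun z : ↥(X ×ˢ Y) => gx z.1.1 z.1.2)
    (hgy : Measurable fun z : ↥(X ×ˢ Y) => gy z.1.1 z.1.2)
    {N : Seminorm ℝ (Vec d₁)} {K D Ψ₁ Ψ₂ : ℝ} (hK : ∀ x ∈ X, ∀ y ∈ Y, ‖gx x y‖ ≤ K)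
    (hΨ₁0 : 0 ≤ Ψ₁) (hΨ₁ : ∀ z, N z ≤ Ψ₁ * ‖z‖) (hΨ₂0 : 0 ≤ Ψ₂) (hΨ₂ : ∀ z, ‖z‖ ≤ Ψ₂ * N z)
    (hD : normDiam N X ≤ D) (t : Fin T) :
    AEStronglyMeasurable (A.x t) μ ∧ Integrable (A.noiseTerm t) μ ∧
    ∫ ω, A.noiseTerm t ω ∂μ = 0 ∧ ∀ p : ℝ, 0 ≤ p → p ≤ 2 →
      (Integrable (fun ω => A.actDev N t ω ^ p) μ ∧
        ∫ ω, A.actDev N t ω ^ p ∂μ ≤ (Ψ₁ * Ψ₂ * D / √(m : ℝ)) ^ p) ∧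
      (Integrable (fun ω => A.predDev N t ω ^ p) μ ∧
        ∫ ω, A.predDev N t ω ^ p ∂μ ≤ (Ψ₁ * Ψ₂ * D / √(m : ℝ)) ^ p) := by
  have hD0 : 0 ≤ D := normDiam_nonneg.trans hD
  -- The variance bound is Euclidean: `Ψ₂` converts the diameter into the Euclidean norm, and `Ψ₁`
  -- converts the deviations back into `N`.
  have hB : ∀ x ∈ X, ∀ y ∈ X, ‖x - y‖ ≤ Ψ₂ * D := fun x hx y hy =>
    (hΨ₂ _).trans (mul_le_mul_of_nonneg_left ((sub_le_normDiam hX hx hy).trans hD) hΨ₂0)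
  obtain ⟨hx, hxP, hact, hpred, hvar₁, hvar₂, hgact, hcent⟩ := A.prediction_facts hm hX hXc hXn
    hP₁ hY hYc hYn hP₂ hgx hgy hB hK t
  have hactX : ∀ ω, A.actMean t ω ∈ X := fun ω => gradPhi_mem hX hXc hXn hP₁ _
  have hpredX : ∀ ω, A.predMean t ω ∈ X := fun ω => gradPhi_mem hX hXc hXn hP₁ _
  have hm' : (0 : ℝ) < m := by positivity
  have hv : Ψ₁ ^ 2 * ((Ψ₂ * D) ^ 2 / m) = (Ψ₁ * Ψ₂ * D / √(m : ℝ)) ^ 2 := by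
    rw [div_pow, Real.sq_sqrt hm'.le]; ring
  have hs : 0 ≤ Ψ₁ * Ψ₂ * D / √(m : ℝ) := by positivity
  refine ⟨hx, ?_, hcent, fun p hp0 hp2 => ⟨?_, ?_⟩⟩
  · refine Integrable.of_bound (hgact.inner (hx.sub hact)) (K * (Ψ₂ * D))
      (Filter.Eventually.of_forall fun ω => ?_)
    have h1 := hK _ (hactX ω) _ (A.y_mem hm hYc t ω)
    exact (norm_inner_le_norm _ _).trans (mul_le_mul h1
      (hB _ (A.x_mem hm hXc t ω) _ (hactX ω)) (norm_nonneg _) ((norm_nonneg _).trans h1))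
  · exact integral_seminorm_rpow_le (hx.sub hact)
      (fun ω => hB _ (A.x_mem hm hXc t ω) _ (hactX ω)) hΨ₁0 hΨ₁ hvar₁ hs hv hp0 hp2
  · exact integral_seminorm_rpow_le (hxP.sub hpred)
      (fun ω => hB _ (A.xPred_mem hm hXc t ω) _ (hpredX ω)) hΨ₁0 hΨ₁ hvar₂ hs hv hp0 hp2

variable [SFinite P₁] [SFinite P₂]

/-- The `y` player's regret bound, obtained from `A.swap`, refers to its opponent through
`A.swap.swap`, where the gradients carry a double negation. -/
lemma swap_swap_actDev (N : Seminorm ℝ (Vec d₁)) (t : Fin T) (ω : Ω) :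
    A.swap.swap.actDev N t ω = A.actDev N t ω := by
  simp only [actDev, actMean, gradSum, gradGuess, neg_neg]
  rfl

lemma swap_swap_predDev (N : Seminorm ℝ (Vec d₁)) (t : Fin T) (ω : Ω) :
    A.swap.swap.predDev N t ω = A.predDev N t ω := by
  simp only [predDev, predMean, gradSum, neg_neg]
  rfl

lemma swap_swap_meanShift (N : Seminorm ℝ (Vec d₁)) (t : Fin T) (ω : Ω) :
    A.swap.swap.meanShift N t ω = A.meanShift N t ω := by
  simp only [meanShift, actMean, predMean, gradSum, gradGuess, neg_neg]
  rfl

end OFTPLPlay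

end

/-- The duality gap of optimistic follow the perturbed leader in smooth convex-concave games. -/
theorem mainTheorem6 {d₁ d₂ : ℕ}
    -- the norms on the two spaces
    (N₁ : Seminorm ℝ (Vec d₁)) (hN₁ : ∀ x, N₁ x = 0 → x = 0)
    (N₂ : Seminorm ℝ (Vec d₂)) (hN₂ : ∀ y, N₂ y = 0 → y = 0)
    -- the domains
    (X : Set (Vec d₁)) (hX : IsCompact X) (hXc : Convex ℝ X) (hXn : X.Nonempty)
    (Y : Set (Vec d₂)) (hY : IsCompact Y) (hYc : Convex ℝ Y) (hYn : Y.Nonempty)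
    -- the payoff and its partial gradients
    (f : Vec d₁ → Vec d₂ → ℝ)
    (gx : Vec d₁ → Vec d₂ → Vec d₁) (gy : Vec d₁ → Vec d₂ → Vec d₂)
    (hgx : ∀ x ∈ X, ∀ y ∈ Y, HasGradientWithinAt (fun x' => f x' y) (gx x y) X x)
    (hgy : ∀ x ∈ X, ∀ y ∈ Y, HasGradientWithinAt (fun y' => f x y') (gy x y) Y y)
    (hgx_meas : Measurable fun z : ↥(X ×ˢ Y) => gx z.1.1 z.1.2)
    (hgy_meas : Measurable fun z : ↥(X ×ˢ Y) => gy z.1.1 z.1.2)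
    (hf_convex : ∀ y ∈ Y, ConvexOn ℝ X fun x => f x y)
    (hf_concave : ∀ x ∈ X, ConcaveOn ℝ Y fun y => f x y)
    -- Hölder smoothness
    (α L₁ L₂ : ℝ) (hα₀ : 0 ≤ α) (hα₁ : α ≤ 1) (hL₁ : 0 ≤ L₁) (hL₂ : 0 ≤ L₂)
    (hsmooth_x : ∀ x ∈ X, ∀ y ∈ Y, ∀ x' ∈ X, ∀ y' ∈ Y,
      dualNorm N₁ (gx x y - gx x' y')
        ≤ L₁ * holderPow α (N₁ (x - x')) + L₂ * holderPow α (N₂ (y - y')))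
    (hsmooth_y : ∀ x ∈ X, ∀ y ∈ Y, ∀ x' ∈ X, ∀ y' ∈ Y,
      dualNorm N₂ (gy x y - gy x' y')
        ≤ L₂ * holderPow α (N₁ (x - x')) + L₁ * holderPow α (N₂ (y - y')))
    (L D Ψ₁ Ψ₂ : ℝ) (hL : L = max L₁ L₂)
    (hD : D = max (normDiam N₁ X) (normDiam N₂ Y))
    (hΨ₁ : Ψ₁ = max (compatConst₁ N₁) (compatConst₁ N₂))
    (hΨ₂ : Ψ₂ = max (compatConst₂ N₁) (compatConst₂ N₂))
    -- the perturbation distributions and stability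
    (P₁ : Measure (Vec d₁)) [IsProbabilityMeasure P₁] (hP₁ : P₁ ≪ volume)
    (P₂ : Measure (Vec d₂)) [IsProbabilityMeasure P₂] (hP₂ : P₂ ≪ volume)
    (η C : ℝ) (hC : 0 ≤ C)
    (hint₁ : Integrable (dualNorm N₁) P₁) (hη₁ : ∫ σ, dualNorm N₁ σ ∂P₁ = η)
    (hint₂ : Integrable (dualNorm N₂) P₂) (hη₂ : ∫ σ, dualNorm N₂ σ ∂P₂ = η)
    (hstable₁ : PredictionsStable (dualNorm N₁) X P₁ (C * η⁻¹))
    (hstable₂ : PredictionsStable (dualNorm N₂) Y P₂ (C * η⁻¹))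
    -- the run of the algorithm
    {Ω : Type*} [MeasurableSpace Ω] (μ : Measure Ω) [IsProbabilityMeasure μ]
    (T m : ℕ) (hT : 0 < T) (hm : 0 < m)
    (A : OFTPLPlay μ X Y gx gy P₁ P₂ T m) :
    ∀ x ∈ X, ∀ y ∈ Y,
      Integrable (fun ω => f (vecMean fun t => A.x t ω) y - f x (vecMean fun t => A.y t ω)) μ ∧
      (α < 1 →
        ∫ ω, (f (vecMean fun t => A.x t ω) y - f x (vecMean fun t => A.y t ω)) ∂μ
          ≤ 2 * L₁ * (Ψ₁ * Ψ₂ * D / √(m : ℝ)) ^ (1 + α) + 2 * η * D / T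
            + 20 * C * L ^ 2 / η * (Ψ₁ * Ψ₂ * D / √(m : ℝ)) ^ (2 * α)
            + 10 * L * (5 * C * L / η) ^ ((1 + α) / (1 - α))) ∧
      (α = 1 → 5 * C * L ≤ η →
        ∫ ω, (f (vecMean fun t => A.x t ω) y - f x (vecMean fun t => A.y t ω)) ∂μ
          ≤ 2 * L₁ * (Ψ₁ * Ψ₂ * D / √(m : ℝ)) ^ (1 + α) + 2 * η * D / T
            + 20 * C * L ^ 2 / η * (Ψ₁ * Ψ₂ * D / √(m : ℝ)) ^ (2 * α)) := by
  intro x hx y hy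
  have hη0 : 0 ≤ η := hη₁ ▸ integral_nonneg fun σ => dualNorm_nonneg hN₁ σ
  -- If `η = 0`, this is zero, consistently with the default values of the quotients by `η` in the
  -- conclusion.
  set β := C * η⁻¹ with hβdef
  have hβ : 0 ≤ β := by positivity
  have hL₁L : L₁ ≤ L := hL ▸ le_max_left _ _
  have hL₂L : L₂ ≤ L := hL ▸ le_max_right _ _
  have hL0 : 0 ≤ L := hL₁.trans hL₁L
  have hD₁ : normDiam N₁ X ≤ D := hD ▸ le_max_left _ _
  have hD₂ : normDiam N₂ Y ≤ D := hD ▸ le_max_right _ _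
  have hΨ₁0 : 0 ≤ Ψ₁ := hΨ₁ ▸ compatConst₁_nonneg.trans (le_max_left _ _)
  have hΨ₂0 : 0 ≤ Ψ₂ := hΨ₂ ▸ compatConst₂_nonneg.trans (le_max_left _ _)
  have hΨ₁x : ∀ z, N₁ z ≤ Ψ₁ * ‖z‖ := fun z => (seminorm_le_compatConst hN₁ z).trans
    (mul_le_mul_of_nonneg_right (hΨ₁ ▸ le_max_left _ _) (norm_nonneg z))
  have hΨ₁y : ∀ z, N₂ z ≤ Ψ₁ * ‖z‖ := fun z => (seminorm_le_compatConst hN₂ z).trans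
    (mul_le_mul_of_nonneg_right (hΨ₁ ▸ le_max_right _ _) (norm_nonneg z))
  have hΨ₂x : ∀ z, ‖z‖ ≤ Ψ₂ * N₁ z := fun z => (norm_le_compatConst hN₁ z).trans
    (mul_le_mul_of_nonneg_right (hΨ₂ ▸ le_max_left _ _) (apply_nonneg N₁ z))
  have hΨ₂y : ∀ z, ‖z‖ ≤ Ψ₂ * N₂ z := fun z => (norm_le_compatConst hN₂ z).trans
    (mul_le_mul_of_nonneg_right (hΨ₂ ▸ le_max_right _ _) (apply_nonneg N₂ z))
  -- For the swapped game `L₁` again multiplies the displacement of the player whose gradient is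
  -- taken, so the same constants serve.
  have hsmooth_y' : ∀ y ∈ Y, ∀ x ∈ X, ∀ y' ∈ Y, ∀ x' ∈ X,
      dualNorm N₂ (-gy x y - -gy x' y')
        ≤ L₁ * holderPow α (N₂ (y - y')) + L₂ * holderPow α (N₁ (x - x')) := by
    intro y hy x hx y' hy' x' hx'
    have h := hsmooth_y x hx y hy x' hx' y' hy'
    have e : -gy x y - -gy x' y' = -(gy x y - gy x' y') := by abel
    rw [e, dualNorm_neg hN₂, add_comm]
    exact h
  obtain ⟨K₁, hK₁⟩ := exists_gradient_bound hN₁ hX hXn hY hYn hα₀ hL₁ hL₂ hsmooth_x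
  obtain ⟨K₂, hK₂⟩ := exists_gradient_bound (gx := fun y x => -gy x y) hN₂ hY hYn hX hXn hα₀ hL₁
    hL₂ hsmooth_y'
  have hswap : Measurable fun z : ↥(Y ×ˢ X) => (⟨(z.1.2, z.1.1), z.2.2, z.2.1⟩ : ↥(X ×ˢ Y)) :=
    Measurable.subtype_mk (measurable_subtype_coe.snd.prodMk measurable_subtype_coe.fst)
  have hgy_meas' : Measurable fun z : ↥(Y ×ˢ X) => -gy z.1.2 z.1.1 := (hgy_meas.comp hswap).neg
  have hgx_meas' : Measurable fun z : ↥(Y ×ˢ X) => -gx z.1.2 z.1.1 := (hgx_meas.comp hswap).neg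
  have hdx := A.deviation_facts hm hX hXc hXn hP₁ hY hYc hYn hP₂ hgx_meas hgy_meas hK₁ hΨ₁0 hΨ₁x
    hΨ₂0 hΨ₂x hD₁
  have hdy := A.swap.deviation_facts hm hY hYc hYn hP₂ hX hXc hXn hP₁ hgy_meas' hgx_meas' hK₂
    hΨ₁0 hΨ₁y hΨ₂0 hΨ₂y hD₂
  set s := Ψ₁ * Ψ₂ * D / √(m : ℝ) with hs
  have hgap : Integrable
      (fun ω => f (vecMean fun t => A.x t ω) y - f x (vecMean fun t => A.y t ω)) μ := by
    refine Integrable.sub ?_ ?_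
    · exact integrable_comp_of_continuousOn hX (F := fun x' => f x' y)
        (fun z hz => (hgx z hz y hy).hasFDerivWithinAt.continuousWithinAt)
        (aestronglyMeasurable_vecMean fun t => (hdx t).1)
        (fun ω => vecMean_mem hT hXc fun t => A.x_mem hm hXc t ω)
    · exact integrable_comp_of_continuousOn hY
        (fun z hz => (hgy x hx z hz).hasFDerivWithinAt.continuousWithinAt)
        (aestronglyMeasurable_vecMean fun t => (hdy t).1)
        (fun ω => vecMean_mem hT hYc fun t => A.y_mem hm hYc t ω)
  -- All error terms of round `t` except the shifts. Each player's bound contains the deviations of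
  -- both with coefficient `5 / 2 * β * L ^ 2`, hence the factor `5`.
  set E : Fin T → Ω → ℝ := fun t ω => (A.noiseTerm t ω + A.swap.noiseTerm t ω)
    + L₁ * (A.actDev N₁ t ω ^ (1 + α) + A.swap.actDev N₂ t ω ^ (1 + α))
    + 5 * β * L ^ 2 * (A.actDev N₁ t ω ^ (2 * α) + A.predDev N₁ t ω ^ (2 * α)
      + (A.swap.actDev N₂ t ω ^ (2 * α) + A.swap.predDev N₂ t ω ^ (2 * α))) with hEdef
  have hE : ∀ t, Integrable (E t) μ ∧
      ∫ ω, E t ω ∂μ ≤ 2 * L₁ * s ^ (1 + α) + 20 * β * L ^ 2 * s ^ (2 * α) := by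
    intro t
    obtain ⟨-, nx, nx0, mx⟩ := hdx t
    obtain ⟨-, ny, ny0, my⟩ := hdy t
    obtain ⟨⟨ax, ax'⟩, -⟩ := mx (1 + α) (by linarith) (by linarith)
    obtain ⟨⟨ay, ay'⟩, -⟩ := my (1 + α) (by linarith) (by linarith)
    obtain ⟨⟨bx, bx'⟩, ⟨cx, cx'⟩⟩ := mx (2 * α) (by linarith) (by linarith)
    obtain ⟨⟨bv, bv'⟩, ⟨cv, cv'⟩⟩ := my (2 * α) (by linarith) (by linarith)
    have i1 := nx.add ny
    have i2 := (ax.add ay).const_mul L₁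
    have i3 := ((bx.add cx).add (bv.add cv)).const_mul (5 * β * L ^ 2)
    have e : ∫ ω, E t ω ∂μ = (∫ ω, A.noiseTerm t ω ∂μ + ∫ ω, A.swap.noiseTerm t ω ∂μ)
        + L₁ * (∫ ω, A.actDev N₁ t ω ^ (1 + α) ∂μ + ∫ ω, A.swap.actDev N₂ t ω ^ (1 + α) ∂μ)
        + 5 * β * L ^ 2 * (∫ ω, A.actDev N₁ t ω ^ (2 * α) ∂μ + ∫ ω, A.predDev N₁ t ω ^ (2 * α) ∂μ
          + (∫ ω, A.swap.actDev N₂ t ω ^ (2 * α) ∂μ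
            + ∫ ω, A.swap.predDev N₂ t ω ^ (2 * α) ∂μ)) :=
      (integral_add (i1.add i2) i3).trans (congrArg₂ (· + ·)
        ((integral_add i1 i2).trans (congrArg₂ (· + ·) (integral_add nx ny)
          ((integral_const_mul _ _).trans (congrArg (L₁ * ·) (integral_add ax ay)))))
        ((integral_const_mul _ _).trans (congrArg (5 * β * L ^ 2 * ·)
          ((integral_add (bx.add cx) (bv.add cv)).trans
            (congrArg₂ (· + ·) (integral_add bx cx) (integral_add bv cv))))))
    refine ⟨(i1.add i2).add i3, ?_⟩
    rw [e, nx0, ny0]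
    have j1 := mul_le_mul_of_nonneg_left (add_le_add ax' ay') hL₁
    have j2 := mul_le_mul_of_nonneg_left (add_le_add (add_le_add bx' cx') (add_le_add bv' cv'))
      (by positivity : 0 ≤ 5 * β * L ^ 2)
    linarith
  have hT' : (0 : ℝ) < T := by positivity
  -- A pathwise bound, with `ρ` standing for the shift residual of one player so that both ranges of
  -- `α` share the argument. The coefficient `10` is `5` from each of the two regrets.
  have hpt : ∀ ρ : ℝ, (∀ p, 0 ≤ p →
        10 * β * L ^ 2 * p ^ (2 * α) - 1 / (2 * β) * p ^ 2 ≤ ρ) → ∀ ω,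
      f (vecMean fun t => A.x t ω) y - f x (vecMean fun t => A.y t ω)
        ≤ (T : ℝ)⁻¹ * (2 * η * D + ∑ t, (E t ω + 2 * ρ)) := by
    intro ρ hρ ω
    have hxm := fun t => A.x_mem hm hXc t ω
    have hym := fun t => A.y_mem hm hYc t ω
    have c1 := (hf_convex y hy).map_vecMean_le hT hxm
    have c2 := (hf_concave x hx).neg.map_vecMean_le hT hym
    have r1 := A.sum_inner_le hN₁ (N₂ := N₂) hm hX hXc hXn hP₁ hYc hα₀ hα₁ hβ hL₁ hL₁L hL₂L
      hsmooth_x hD₁ hint₁ hη₁ hstable₁ hx ω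
    have r2 := A.swap.sum_inner_le hN₂ (N₂ := N₁) hm hY hYc hYn hP₂ hXc hα₀ hα₁ hβ hL₁ hL₁L hL₂L
      hsmooth_y' hD₂ hint₂ hη₂ hstable₂ hy ω
    simp only [A.swap_swap_actDev, A.swap_swap_predDev, A.swap_swap_meanShift] at r2
    have hlin : ∀ t, f (A.x t ω) y - f x (A.y t ω)
        ≤ inner ℝ (gx (A.x t ω) (A.y t ω)) (A.x t ω - x)
          + inner ℝ (-gy (A.x t ω) (A.y t ω)) (A.y t ω - y) := by
      intro t
      have l1 := (hf_convex _ (hym t)).add_inner_gradient_le (hgx _ (hxm t) _ (hym t)) (hxm t) hx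
      have l2 := (hf_concave _ (hxm t)).neg.add_inner_gradient_le (g := -gy (A.x t ω) (A.y t ω))
        (by
          rw [hasGradientWithinAt_iff_hasFDerivWithinAt, map_neg]
          exact (hgy _ (hxm t) _ (hym t)).hasFDerivWithinAt.neg) (hym t) hy
      have k1 : (inner ℝ (gx (A.x t ω) (A.y t ω)) (A.x t ω - x) : ℝ)
          = -inner ℝ (gx (A.x t ω) (A.y t ω)) (x - A.x t ω) := by
        rw [← inner_neg_right, neg_sub]
      have k2 : (inner ℝ (-gy (A.x t ω) (A.y t ω)) (A.y t ω - y) : ℝ)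
          = -inner ℝ (-gy (A.x t ω) (A.y t ω)) (y - A.y t ω) := by
        rw [← inner_neg_right, neg_sub]
      simp only [Pi.neg_apply] at l2
      rw [k1, k2]
      linarith
    have hsum : ∑ t, (f (A.x t ω) y - f x (A.y t ω)) ≤ 2 * η * D + ∑ t, (E t ω + 2 * ρ) := by
      refine (Finset.sum_le_sum fun t _ => hlin t).trans ?_
      rw [Finset.sum_add_distrib]
      refine (add_le_add r1 r2).trans ?_
      rw [add_add_add_comm, ← Finset.sum_add_distrib]
      refine add_le_add (by linarith) (Finset.sum_le_sum fun t _ => ?_)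
      have h1 := hρ (A.meanShift N₁ t ω) (apply_nonneg N₁ _)
      have h2 := hρ (A.swap.meanShift N₂ t ω) (apply_nonneg N₂ _)
      simp only [hEdef]
      linarith
    have hmul := mul_le_mul_of_nonneg_left hsum (inv_nonneg.2 hT'.le)
    refine le_trans ?_ hmul
    rw [Finset.sum_sub_distrib, mul_sub]
    simp only [Pi.neg_apply, Finset.sum_neg_distrib, mul_neg] at c2
    linarith
  have hbound : ∀ ρ : ℝ, (∀ p, 0 ≤ p →
        10 * β * L ^ 2 * p ^ (2 * α) - 1 / (2 * β) * p ^ 2 ≤ ρ) →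
      ∫ ω, (f (vecMean fun t => A.x t ω) y - f x (vecMean fun t => A.y t ω)) ∂μ
        ≤ 2 * L₁ * s ^ (1 + α) + 2 * η * D / T + 20 * β * L ^ 2 * s ^ (2 * α) + 2 * ρ := by
    intro ρ hρ
    have hi : ∀ t, Integrable (fun ω => E t ω + 2 * ρ) μ := fun t =>
      (hE t).1.add (integrable_const _)
    have hi' : Integrable (fun ω => ∑ t, (E t ω + 2 * ρ)) μ := integrable_finsetSum _ fun t _ => hi t
    refine (integral_mono hgap (((integrable_const (2 * η * D)).add hi').const_mul (T : ℝ)⁻¹)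
      (hpt ρ hρ)).trans ?_
    have e1 : ∀ t, ∫ ω, (E t ω + 2 * ρ) ∂μ = ∫ ω, E t ω ∂μ + 2 * ρ := fun t => by
      rw [integral_add (hE t).1 (integrable_const _)]; simp
    have e2 : ∫ ω, (T : ℝ)⁻¹ * (2 * η * D + ∑ t, (E t ω + 2 * ρ)) ∂μ
        = (T : ℝ)⁻¹ * (2 * η * D + ∑ t, (∫ ω, E t ω ∂μ + 2 * ρ)) := by
      rw [integral_const_mul, integral_add (integrable_const _) hi',
        integral_finsetSum _ fun t _ => hi t]
      simp [e1]
    refine e2.trans_le ?_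
    have e3 := Finset.sum_le_sum fun t (_ : t ∈ (Finset.univ : Finset (Fin T))) =>
      add_le_add_left (hE t).2 (2 * ρ)
    rw [Finset.sum_const, Finset.card_univ, Fintype.card_fin, nsmul_eq_mul] at e3
    refine (mul_le_mul_of_nonneg_left (add_le_add_right e3 _) (inv_nonneg.2 hT'.le)).trans_eq ?_
    field_simp
    ring
  have hb20 : 20 * C * L ^ 2 / η = 20 * β * L ^ 2 := by rw [hβdef]; ring
  have hb5 : 5 * C * L / η = 5 * β * L := by rw [hβdef]; ring
  refine ⟨hgap, fun hα => ?_, fun hα hηL => ?_⟩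
  · rw [hb20, hb5]
    refine (hbound _ fun p hp => shift_residual_le hα₀ hα hβ hL0 hp).trans_eq ?_
    ring
  · rw [hb20]
    have h5 : 5 * β * L ≤ 1 := by
      rw [← hb5]
      exact div_le_one_of_le₀ hηL hη0
    -- At `α = 1` the negative squares absorb the shifts completely, so the residual is zero.
    refine (hbound 0 fun p hp => ?_).trans_eq (by ring)
    rw [hα]
    exact shift_residual_le_of_eq_one hβ hL0 h5
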